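/- Let $f_1,f_2\in C^3([0,1])$ and let $\mathcal C=\{(x,f_1(x),f_2(x)):x\in[0,1]\}\subset\mathbb R^3$ be the resulting compact $C^3$ space curve. Assume that the torsion of $\mathcal C$ vanishes nowhere, i.e. $f_1''(x)f_2'''(x)-f_2''(x)f_1'''(x)\neq 0$ for all $x\in[0,1]$. For $y\in\mathbb R$ let $\|y\|$ denote the distance from $y$ to the nearest integer, and for real $q\ge 1$ and $\delta>0$ put $$A(q,\delta)=\#\{a\in\mathbb Z\cap[0,q]:\ \|q f_1(a/q)\|<\delta,\ \|q f_2(a/q)\|<\delta\}.$$ Then there is a constant $K>0$, depending only on $\mathcal C$, such that for all real $q\ge 2$ and all $\delta\in(0,1/2)$, $$A(q,\delta)\le K\left(\delta^2 q+q^{3/5}(\log q)^{4/5}\right).$$ Furthermore, there are positive constants $C$, $Q_0$ and $c$, depending only on $\mathcal C$, such that for all real $q\ge Q_0$ and all $\delta\in(0,1/2)$ with $\delta\ge Cq^{-1/5}(\log q)^{2/5}$, $$A(q,\delta)\ge c\,\delta^2 q.$$ -/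

import Mathlib

namespace SpaceCurve

open scoped Matrix

/-- The distance `‖x‖` from a real number to the nearest integer. -/
noncomputable def distInt (x : ℝ) : ℝ := |x - (round x : ℝ)|

/-- The torsion `det(γ', γ'', γ''') / |γ' × γ''|²` at the parameter `t` of a curve `γ` in `ℝ³`
parametrized by `s ⊆ ℝ`; the derivatives are taken within `s` (one-sided at end points of an
interval). Where `γ' × γ'' = 0` the torsion is undefined, and the value here is then `0`, so that
`torsionWithin γ s t ≠ 0` says that the torsion at `t` exists and does not vanish. -/
noncomputable def torsionWithin (γ : ℝ → Fin 3 → ℝ) (s : Set ℝ) (t : ℝ) : ℝ :=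
  (Matrix.of ![iteratedDerivWithin 1 γ s t, iteratedDerivWithin 2 γ s t,
      iteratedDerivWithin 3 γ s t]).det /
    (crossProduct (iteratedDerivWithin 1 γ s t) (iteratedDerivWithin 2 γ s t) ⬝ᵥ
      crossProduct (iteratedDerivWithin 1 γ s t) (iteratedDerivWithin 2 γ s t))

/-- The parametrization `x ↦ (x, f₁ x, f₂ x)` of a space curve in Monge form. -/
def monge (f₁ f₂ : ℝ → ℝ) : ℝ → Fin 3 → ℝ := fun x => ![x, f₁ x, f₂ x]

/-- `A(q, δ)`: the number of integers `a ∈ [0, q]` with `‖q f₁(a/q)‖ < δ` and `‖q f₂(a/q)‖ < δ`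
(a finite set). -/
noncomputable def latticeCount (f₁ f₂ : ℝ → ℝ) (q δ : ℝ) : ℕ :=
  Set.ncard {a : ℤ | 0 ≤ (a : ℝ) ∧ (a : ℝ) ≤ q ∧
    distInt (q * f₁ ((a : ℝ) / q)) < δ ∧ distInt (q * f₂ ((a : ℝ) / q)) < δ}

end SpaceCurve

/-!
The argument is elementary and even avoids the logarithms. Write `e x = exp (2πix)` and let `w` be
the `1`-periodic tent `max 0 (δ - ‖y‖)`. Up to replacing `δ` by `2δ`, `A(q, δ)` is comparable to
`δ⁻² ∑ₐ w (q f₁(a/q)) w (q f₂(a/q))`. Expanding both tents in (absolutely convergent) Fourier series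
whose coefficients are at most `min (2δ²) (1/n²)`, the zero frequency contributes the main term
`δ⁴ q`, and the rest is controlled by the Weyl sums
`S(j₁, j₂) = ∑ₐ e (q F(a/q))`, `F = j₁ f₁ + j₂ f₂`
(`abs_sum_tent_mul_tent_sub_le`).

Put `J = max |j₁| |j₂|`. Nonvanishing torsion means that the pairs formed by the second and third
derivatives of `f₁` and of `f₂` are linearly independent at each point, so by compactness the second
and third derivatives of `F` are never both small compared with `J` (`exists_uniform_lower_bound`).
Hence `[0, 1]` splits into a bounded number of intervals on each of which the second derivative is
at least `c J |x - x₀|` in absolute value for some point `x₀`, with a fixed sign on either side of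
it. Blocks whose distance from `x₀` grows geometrically are estimated by van der Corput's second
derivative test (`norm_sum_e_le_of_secondDiff`), itself a consequence of the Kuzmin–Landau
inequality (`norm_sum_e_le_of_gap`), and the `r² q` terms next to `x₀` trivially. This gives
`S(j₁, j₂) ≪ √(qJ) + √(q/J) / r + q r²` for every `r ∈ (0, 1]` (`exists_norm_expSum_le`).

With `r = εδ`, summation over the frequencies yields a total error
`≪ √q δ^(3/2) / ε + ε² δ⁴ q` (`exists_abs_sum_tent_sub_le`). When `q δ⁵ ≥ 1` this is `≪ δ⁴ q`, which
is the upper bound; smaller `δ` are handled by monotonicity, since `δ = q^(-1/5)` gives `δ² q =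
q^(3/5)`. When `q δ⁵` is large and `ε` is small, the error is less than half the main term, which is
the lower bound. The powers of `log q` in the theorem are bounded below and are only used in that
way.
-/

open Real Finset

namespace SpaceCurve

/-! ### Exponential sums and the second derivative test -/

/-- The additive character `x ↦ exp (2πix)` of `ℝ / ℤ`. -/
noncomputable def e (x : ℝ) : ℂ := Complex.exp (2 * π * x * Complex.I)

lemma e_add (x y : ℝ) : e (x + y) = e x * e y := by
  unfold e; rw [← Complex.exp_add]; congr 1; push_cast; ring

lemma norm_e (x : ℝ) : ‖e x‖ = 1 := by
  unfold e
  have : (2 * π * x * Complex.I : ℂ) = ((2 * π * x : ℝ) : ℂ) * Complex.I := by push_cast; ring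
  rw [this, Complex.norm_exp_ofReal_mul_I]

lemma e_re (x : ℝ) : (e x).re = cos (2 * π * x) := by
  unfold e
  have : (2 * π * x * Complex.I : ℂ) = ((2 * π * x : ℝ) : ℂ) * Complex.I := by push_cast; ring
  rw [this, Complex.exp_ofReal_mul_I_re]

lemma e_eq (x : ℝ) : e x = (cos (2 * π * x) : ℂ) + (sin (2 * π * x) : ℂ) * Complex.I := by
  unfold e
  rw [Complex.exp_mul_I]; push_cast; rfl

lemma e_neg (x : ℝ) : e (-x) = (starRingEnd ℂ) (e x) := by
  apply Complex.ext <;> simp [e_eq, -Complex.ofReal_cos, -Complex.ofReal_sin]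

/-- The value of `1 / (1 - e x)`, for `sin (π x) ≠ 0`, written with the cotangent. -/
noncomputable def geomCoeff (x : ℝ) : ℂ :=
  1 / 2 + (cos (π * x) / sin (π * x) / 2 : ℝ) * Complex.I

lemma geomCoeff_mul {x : ℝ} (hx : sin (π * x) ≠ 0) : geomCoeff x * (1 - e x) = 1 := by
  have h1 : cos (2 * π * x) = 1 - 2 * (sin (π * x) * sin (π * x)) := by
    rw [show 2 * π * x = 2 * (π * x) by ring, cos_two_mul]; nlinarith [sin_sq_add_cos_sq (π * x)]
  have h2 : sin (2 * π * x) = 2 * sin (π * x) * cos (π * x) := by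
    rw [show 2 * π * x = 2 * (π * x) by ring, sin_two_mul]
  have h3 := sin_sq_add_cos_sq (π * x)
  rw [e_eq, h1, h2, geomCoeff]
  apply Complex.ext
  · simp [-Complex.ofReal_sin, -Complex.ofReal_cos, -Complex.ofReal_div]
    field_simp
    linear_combination h3
  · simp [-Complex.ofReal_sin, -Complex.ofReal_cos, -Complex.ofReal_div]
    field_simp
    ring

lemma norm_geomCoeff {x : ℝ} (hx : sin (π * x) ≠ 0) :
    ‖geomCoeff x‖ = 1 / (2 * |sin (π * x)|) := by
  have h3 := sin_sq_add_cos_sq (π * x)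
  have h0 : 0 < |sin (π * x)| := abs_pos.mpr hx
  have : ‖geomCoeff x‖ ^ 2 = (1 / (2 * |sin (π * x)|)) ^ 2 := by
    rw [← Complex.normSq_eq_norm_sq, Complex.normSq_apply, geomCoeff]
    simp [-Complex.ofReal_sin, -Complex.ofReal_cos, -Complex.ofReal_div]
    rw [mul_pow, inv_pow, sq_abs]
    field_simp
    linarith
  exact (pow_left_inj₀ (norm_nonneg _) (by positivity) two_ne_zero).mp this

lemma norm_geomCoeff_sub (x y : ℝ) : ‖geomCoeff y - geomCoeff x‖ =
    |cos (π * y) / sin (π * y) - cos (π * x) / sin (π * x)| / 2 := by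
  have : geomCoeff y - geomCoeff x =
      (((cos (π * y) / sin (π * y) - cos (π * x) / sin (π * x)) / 2 : ℝ) : ℂ) * Complex.I := by
    unfold geomCoeff; push_cast; ring
  rw [this, norm_mul, Complex.norm_I, Complex.norm_real, mul_one, Real.norm_eq_abs, abs_div]
  norm_num

lemma sin_lower {Δ t : ℝ} (hΔ : 0 < Δ) (h1 : Δ ≤ t) (h2 : t ≤ 1 - Δ) :
    2 * Δ ≤ sin (π * t) := by
  rcases le_total t (1 / 2) with h | h
  · have := mul_le_sin (x := π * t) (mul_nonneg pi_pos.le (by linarith))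
      (by nlinarith [pi_pos])
    have h4 : 2 / π * (π * t) = 2 * t := by field_simp
    linarith
  · have := mul_le_sin (x := π * (1 - t)) (mul_nonneg pi_pos.le (by linarith))
      (by nlinarith [pi_pos])
    have h4 : 2 / π * (π * (1 - t)) = 2 * (1 - t) := by field_simp
    have h5 : sin (π * (1 - t)) = sin (π * t) := by
      rw [show π * (1 - t) = π - π * t by ring, sin_pi_sub]
    linarith

lemma abs_sin_pi_lower {Δ x : ℝ} {k : ℤ} (hΔ : 0 < Δ) (h1 : k + Δ ≤ x) (h2 : x ≤ k + 1 - Δ) :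
    2 * Δ ≤ |sin (π * x)| := by
  have h := sin_lower (t := x - k) hΔ (by linarith) (by linarith)
  have : sin (π * x) = (-1) ^ k * sin (π * (x - k)) := by
    rw [show π * x = π * (x - k) + k * π by ring, sin_add_int_mul_pi]
  rw [this, abs_mul, abs_zpow, abs_neg, abs_one, one_zpow, one_mul]
  exact h.trans (le_abs_self _)

lemma cot_antitone {x y : ℝ} {k : ℤ} (h1 : k < x) (hxy : x ≤ y) (h2 : y < k + 1) :
    cos (π * y) / sin (π * y) ≤ cos (π * x) / sin (π * x) := by
  have key : ∀ z : ℝ, cos (π * z) / sin (π * z) =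
      cos (π * (z - k)) / sin (π * (z - k)) := fun z ↦ by
    rw [show π * z = π * (z - k) + k * π by ring, sin_add_int_mul_pi, cos_add_int_mul_pi,
      mul_div_mul_left _ _ (zpow_ne_zero _ (by norm_num))]
  rw [key x, key y]
  have sx : 0 < sin (π * (x - k)) := sin_pos_of_pos_of_lt_pi
    (mul_pos pi_pos (by linarith)) (by nlinarith [pi_pos])
  have sy : 0 < sin (π * (y - k)) := sin_pos_of_pos_of_lt_pi
    (mul_pos pi_pos (by linarith)) (by nlinarith [pi_pos])
  rw [div_le_div_iff₀ sy sx]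
  have : 0 ≤ sin (π * (y - k) - π * (x - k)) := sin_nonneg_of_nonneg_of_le_pi
    (by nlinarith [pi_pos]) (by nlinarith [pi_pos])
  rw [sin_sub] at this
  linarith

/-- The **Kuzmin–Landau inequality**. The identity behind it is
`e (g n) = (e (g n) - e (g (n + 1))) / (1 - e (g (n + 1) - g n))`; after summation by parts the
total variation of `1 / (1 - e ·)` telescopes, since the cotangent is monotone. -/
lemma norm_sum_e_le_of_gap (g : ℕ → ℝ) (L : ℕ) {Δ : ℝ} (k : ℤ) (hΔ : 0 < Δ)
    (h1 : ∀ n < L, k + Δ ≤ g (n + 1) - g n) (h2 : ∀ n < L, g (n + 1) - g n ≤ k + 1 - Δ)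
    (hm : ∀ n, n + 1 < L → g (n + 1) - g n ≤ g (n + 2) - g (n + 1)) :
    ‖∑ n ∈ range L, e (g n)‖ ≤ 1 / Δ := by
  set d : ℕ → ℝ := fun n ↦ g (n + 1) - g n with hd
  set c : ℕ → ℝ := fun n ↦ cos (π * d n) / sin (π * d n) with hc
  have hs : ∀ n < L, 2 * Δ ≤ |sin (π * d n)| := fun n hn ↦
    abs_sin_pi_lower hΔ (h1 n hn) (h2 n hn)
  have hs0 : ∀ n < L, sin (π * d n) ≠ 0 := fun n hn h ↦ by
    have := hs n hn; rw [h, abs_zero] at this; linarith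
  have hstep : ∀ n < L, e (g n) + geomCoeff (d n) * e (g (n + 1)) = geomCoeff (d n) * e (g n) := by
    intro n hn
    have h := geomCoeff_mul (hs0 n hn)
    have : g (n + 1) = g n + d n := by simp [hd]
    rw [this, e_add]
    linear_combination -(e (g n)) * h
  have main : ∀ m < L, ‖∑ n ∈ range (m + 1), e (g n) + geomCoeff (d m) * e (g (m + 1))‖ ≤
      ‖geomCoeff (d 0)‖ + (c 0 - c m) / 2 := by
    intro m
    induction m with
    | zero => intro h0; simp [hstep 0 h0, norm_e]
    | succ m ih =>
      intro hm1
      have hml : m < L := by omega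
      rw [sum_range_succ, add_assoc, hstep (m + 1) hm1]
      have : ∑ n ∈ range (m + 1), e (g n) + geomCoeff (d (m + 1)) * e (g (m + 1)) =
          (∑ n ∈ range (m + 1), e (g n) + geomCoeff (d m) * e (g (m + 1))) +
            (geomCoeff (d (m + 1)) - geomCoeff (d m)) * e (g (m + 1)) := by ring
      rw [this]
      refine (norm_add_le _ _).trans ?_
      rw [norm_mul, norm_e, mul_one, norm_geomCoeff_sub, abs_of_nonpos]
      · have := ih hml
        simp only [hc] at this ⊢
        linarith
      · have := cot_antitone (k := k) (x := d m) (y := d (m + 1)) (by linarith [h1 m hml])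
          (hm m hm1) (by linarith [h2 (m + 1) hm1])
        linarith
  rcases L with _ | m
  · simp; positivity
  · have hmain := main m (by omega)
    have hu : ∀ n < m + 1, ‖geomCoeff (d n)‖ ≤ 1 / (4 * Δ) := fun n hn ↦ by
      rw [norm_geomCoeff (hs0 n hn)]
      exact one_div_le_one_div_of_le (by positivity) (by linarith [hs n hn])
    have hcb : ∀ n < m + 1, |c n| ≤ 1 / (2 * Δ) := fun n hn ↦ by
      simp only [hc]
      rw [abs_div]
      exact div_le_div₀ zero_le_one (abs_cos_le_one _) (by positivity) (hs n hn)
    have e1 : ∑ n ∈ range (m + 1), e (g n) =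
        (∑ n ∈ range (m + 1), e (g n) + geomCoeff (d m) * e (g (m + 1))) -
          geomCoeff (d m) * e (g (m + 1)) := by ring
    rw [e1]
    refine (norm_sub_le _ _).trans ?_
    rw [norm_mul, norm_e, mul_one]
    have a1 := hu 0 (by omega)
    have a2 := hu m (by omega)
    have a3 := abs_le.mp (hcb 0 (by omega))
    have a4 := abs_le.mp (hcb m (by omega))
    have e2 : 1 / Δ = 1 / (4 * Δ) + (1 / (2 * Δ) + 1 / (2 * Δ)) / 2 + 1 / (4 * Δ) := by
      field_simp; norm_num
    rw [e2]
    linarith [a3.2, a4.1]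

lemma norm_sum_e_le_card (g : ℕ → ℝ) (s : Finset ℕ) : ‖∑ n ∈ s, e (g n)‖ ≤ s.card := by
  refine (norm_sum_le _ _).trans ?_
  simp [norm_e]

lemma exists_eq_Ico_of_ordConnected (s : Finset ℕ) (hs : (s : Set ℕ).OrdConnected) :
    ∃ a b, a ≤ b ∧ s = Ico a b := by
  rcases s.eq_empty_or_nonempty with rfl | hne
  · exact ⟨0, 0, le_rfl, by simp⟩
  · refine ⟨s.min' hne, s.max' hne + 1, ?_, ?_⟩
    · have := s.min'_le _ (s.max'_mem hne); omega
    · ext n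
      rw [mem_Ico, Nat.lt_succ_iff]
      exact ⟨fun h ↦ ⟨s.min'_le _ h, s.le_max' _ h⟩,
        fun h ↦ hs.out (s.min'_mem hne) (s.max'_mem hne) h⟩

/-- The **second derivative test of van der Corput**, in terms of second differences. The first
differences `d` spend at most `O (Δ / λ + 1)` steps within `Δ` of any given integer, and the terms
between two such stretches are handled by `norm_sum_e_le_of_gap`; the choice `Δ = √λ / 2`
balances the two contributions. -/
lemma norm_sum_e_le_of_secondDiff (g : ℕ → ℝ) (L : ℕ) {l U : ℝ} (hl : 0 < l) (hl1 : l ≤ 1)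
    (hU : 0 ≤ U) (h1 : ∀ n, n + 1 < L → l ≤ g (n + 2) - 2 * g (n + 1) + g n)
    (h2 : ∀ n, n + 1 < L → g (n + 2) - 2 * g (n + 1) + g n ≤ U) :
    ‖∑ n ∈ range L, e (g n)‖ ≤ (U * L + 2) * (5 / √l) := by
  set d : ℕ → ℝ := fun n ↦ g (n + 1) - g n with hd
  have hlow : ∀ n m, n ≤ m → m < L → l * (m - n : ℝ) ≤ d m - d n := by
    intro n m hnm
    induction m, hnm using Nat.le_induction with
    | base => simp
    | succ m hm ih =>
      intro hL
      have := ih (by omega); have := h1 m hL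
      simp only [hd] at *; push_cast; linarith
  have hup : ∀ m < L, d m - d 0 ≤ U * m := by
    intro m
    induction m with
    | zero => simp
    | succ m ih =>
      intro hL
      have := ih (by omega); have := h2 m hL
      simp only [hd] at *; push_cast; linarith
  have hmono : ∀ n m, n ≤ m → m < L → d n ≤ d m := fun n m hnm hm ↦ by
    have h := hlow n m hnm hm
    have : (0 : ℝ) ≤ m - n := sub_nonneg.mpr (by exact_mod_cast hnm)
    nlinarith
  rcases Nat.eq_zero_or_pos L with rfl | hL
  · simp; positivity
  have hsl : 0 < √l := sqrt_pos.mpr hl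
  have hsl1 : √l ≤ 1 := sqrt_le_one.mpr hl1
  have hsq : √l * √l = l := mul_self_sqrt hl.le
  set Δ : ℝ := √l / 2 with hΔd
  have hΔ : 0 < Δ := by positivity
  -- the steps on which `d` lies in an interval of length `Δ`
  have hcount : ∀ (x : ℝ) (s : Finset ℕ), s ⊆ range L → (s : Set ℕ).OrdConnected →
      (∀ n ∈ s, x ≤ d n ∧ d n ≤ x + Δ) → ‖∑ n ∈ s, e (g n)‖ ≤ Δ / l + 1 := by
    intro x s hsL hs hx
    refine (norm_sum_e_le_card g s).trans ?_
    obtain ⟨a, b, hab, rfl⟩ := exists_eq_Ico_of_ordConnected s hs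
    rcases hab.eq_or_lt with rfl | hab
    · simp; positivity
    have ha := hx a (by simp [hab])
    have hb := hx (b - 1) (by simp; omega)
    have hbL : b - 1 < L := by
      have := hsL (show b - 1 ∈ Ico a b by simp; omega)
      simpa using this
    have h := hlow a (b - 1) (by omega) hbL
    rw [Nat.card_Ico, Nat.cast_sub hab.le]
    rw [Nat.cast_sub (by omega)] at h
    push_cast at h
    have : (b - 1 - a : ℝ) ≤ Δ / l := by rw [le_div_iff₀ hl]; linarith
    linarith
  have hmid : ∀ (k : ℤ) (s : Finset ℕ), s ⊆ range L → (s : Set ℕ).OrdConnected →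
      (∀ n ∈ s, k + Δ ≤ d n ∧ d n ≤ k + 1 - Δ) → ‖∑ n ∈ s, e (g n)‖ ≤ 1 / Δ := by
    intro k s hsL hs hx
    obtain ⟨a, b, hab, rfl⟩ := exists_eq_Ico_of_ordConnected s hs
    rw [sum_Ico_eq_sum_range]
    refine norm_sum_e_le_of_gap (fun n ↦ g (a + n)) (b - a) k hΔ ?_ ?_ ?_
    · intro n hn; exact (hx (a + n) (by simp; omega)).1
    · intro n hn; exact (hx (a + n) (by simp; omega)).2
    · intro n hn
      have : a + n + 1 < L := by
        have := hsL (show a + n + 1 ∈ Ico a b by simp; omega)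
        simpa using this
      exact hmono (a + n) (a + n + 1) (by omega) this
  have hord : ∀ (p : ℝ → Prop) [DecidablePred p], {x | p x}.OrdConnected →
      ((({n ∈ range L | p (d n)} : Finset ℕ)) : Set ℕ).OrdConnected := by
    intro p _ hp
    refine ⟨fun n hn m hm i hi ↦ ?_⟩
    simp only [coe_filter, Set.mem_ofPred_eq, mem_range] at hn hm ⊢
    have hiL : i < L := lt_of_le_of_lt hi.2 hm.1
    exact ⟨hiL, hp.out hn.2 hm.2 ⟨hmono _ _ hi.1 hiL, hmono _ _ hi.2 hm.1⟩⟩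
  have hfib : ∀ k : ℤ, ‖∑ n ∈ range L with ⌊d n⌋ = k, e (g n)‖ ≤ 5 / √l := by
    intro k
    have hΔ2 : Δ ≤ 1 / 2 := by rw [hΔd]; linarith
    have hsplit : ∑ n ∈ range L with ⌊d n⌋ = k, e (g n) =
        ∑ n ∈ range L with (k ≤ d n ∧ d n < k + Δ), e (g n) +
        (∑ n ∈ range L with (k + Δ ≤ d n ∧ d n ≤ k + 1 - Δ), e (g n) +
        ∑ n ∈ range L with (k + 1 - Δ < d n ∧ d n < k + 1), e (g n)) := by
      rw [← sum_union, ← sum_union]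
      · congr 1
        ext n
        simp only [mem_filter, mem_union, Int.floor_eq_iff]
        constructor
        · rintro ⟨h0, h1, h2⟩
          rcases lt_or_ge (d n) (k + Δ) with h | h
          · exact Or.inl ⟨h0, h1, h⟩
          · rcases le_or_gt (d n) (k + 1 - Δ) with h' | h'
            · exact Or.inr (Or.inl ⟨h0, h, h'⟩)
            · exact Or.inr (Or.inr ⟨h0, h', h2⟩)
        · rintro (⟨h0, h1, h2⟩ | ⟨h0, h1, h2⟩ | ⟨h0, h1, h2⟩)
          · exact ⟨h0, h1, by linarith⟩
          · exact ⟨h0, by linarith, by linarith⟩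
          · exact ⟨h0, by linarith, by linarith⟩
      · rw [disjoint_left]
        intro n hn hn'
        simp only [mem_filter, mem_union] at hn hn'
        rcases hn' with h | h <;> linarith [hn.2.2, h.2.1]
      · rw [disjoint_left]
        intro n hn hn'
        simp only [mem_filter] at hn hn'
        linarith [hn.2.2, hn'.2.1]
    rw [hsplit]
    have b1 : ‖∑ n ∈ range L with (k ≤ d n ∧ d n < k + Δ), e (g n)‖ ≤ Δ / l + 1 := by
      refine hcount k _ (filter_subset _ _)
        (hord (fun x ↦ (k : ℝ) ≤ x ∧ x < k + Δ) Set.ordConnected_Ico) fun n hn ↦ ?_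
      have := (mem_filter.mp hn).2
      exact ⟨this.1, this.2.le⟩
    have b2 : ‖∑ n ∈ range L with (k + Δ ≤ d n ∧ d n ≤ k + 1 - Δ), e (g n)‖ ≤ 1 / Δ :=
      hmid k _ (filter_subset _ _)
        (hord (fun x ↦ (k : ℝ) + Δ ≤ x ∧ x ≤ k + 1 - Δ) Set.ordConnected_Icc)
        (fun n hn ↦ (mem_filter.mp hn).2)
    have b3 : ‖∑ n ∈ range L with (k + 1 - Δ < d n ∧ d n < k + 1), e (g n)‖ ≤ Δ / l + 1 := by
      refine hcount (k + 1 - Δ) _ (filter_subset _ _)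
        (hord (fun x ↦ (k : ℝ) + 1 - Δ < x ∧ x < k + 1) Set.ordConnected_Ioo) fun n hn ↦ ?_
      have := (mem_filter.mp hn).2
      exact ⟨this.1.le, by linarith [this.2]⟩
    refine (norm_add_le _ _).trans ((add_le_add_right (norm_add_le _ _) _).trans ?_)
    have e1 : Δ / l = 1 / 2 * (1 / √l) := by
      rw [hΔd]; nth_rewrite 2 [← hsq]; field_simp
    have e2 : 1 / Δ = 2 * (1 / √l) := by rw [hΔd]; field_simp
    have e3 : 5 / √l = 5 * (1 / √l) := by field_simp
    have e4 : 1 ≤ 1 / √l := by rw [le_div_iff₀ hsl]; linarith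
    rw [e1] at b1 b3
    rw [e2] at b2
    rw [e3]
    linarith
  have hmaps : ∀ n ∈ range L, ⌊d n⌋ ∈ Icc ⌊d 0⌋ ⌊d (L - 1)⌋ := by
    intro n hn
    have hn := mem_range.mp hn
    exact mem_Icc.mpr ⟨Int.floor_le_floor (hmono 0 n (by omega) hn),
      Int.floor_le_floor (hmono n (L - 1) (by omega) (by omega))⟩
  rw [← sum_fiberwise_of_maps_to hmaps]
  refine (norm_sum_le _ _).trans ((sum_le_sum fun k _ ↦ hfib k).trans ?_)
  rw [sum_const, nsmul_eq_mul]
  refine mul_le_mul_of_nonneg_right ?_ (by positivity)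
  have hle : ⌊d 0⌋ ≤ ⌊d (L - 1)⌋ := Int.floor_le_floor (hmono 0 (L - 1) (by omega) (by omega))
  rw [Int.card_Icc]
  have hc : (((⌊d (L - 1)⌋ + 1 - ⌊d 0⌋).toNat : ℤ) : ℝ) = ⌊d (L - 1)⌋ + 1 - ⌊d 0⌋ := by
    rw [Int.toNat_of_nonneg (by omega)]; push_cast; ring
  have hc' : ((⌊d (L - 1)⌋ + 1 - ⌊d 0⌋).toNat : ℝ) = ⌊d (L - 1)⌋ + 1 - ⌊d 0⌋ := by
    rw [← hc]; push_cast; rfl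
  rw [hc']
  have h3 := hup (L - 1) (by omega)
  have h4 := Int.floor_le (d (L - 1))
  have h5 := Int.lt_floor_add_one (d 0)
  have h6 : U * ((L - 1 : ℕ) : ℝ) ≤ U * L :=
    mul_le_mul_of_nonneg_left (by exact_mod_cast Nat.sub_le _ _) hU
  linarith

/-! ### Second derivatives with a simple zero -/

/-- Induction over the blocks `[R 4 ^ k, R 4 ^ (k + 1))`, on each of which the second differences
are at least `μ R 4 ^ k`. -/
lemma norm_sum_e_le_of_secondDiff_ge_linear_aux (g : ℕ → ℝ) {μ U R : ℝ} (hμ : 0 < μ) (hU : 0 ≤ U)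
    (hR : 1 ≤ R) (k : ℕ) : ∀ L : ℕ, (L : ℝ) ≤ R * 4 ^ k → μ * L ≤ 1 →
    (∀ n, n + 1 < L → μ * n ≤ g (n + 2) - 2 * g (n + 1) + g n) →
    (∀ n, n + 1 < L → g (n + 2) - 2 * g (n + 1) + g n ≤ U) →
    ‖∑ n ∈ range L, e (g n)‖ ≤
      R + 40 * U * R / √(μ * R) * 2 ^ k + 40 / √(μ * R) * (1 - 1 / 2 ^ k) := by
  have hw : 0 < √(μ * R) := sqrt_pos.mpr (by positivity)
  induction k with
  | zero =>
    intro L hL _ _ _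
    have := norm_sum_e_le_card g (range L)
    rw [card_range] at this
    have h2 : 0 ≤ 40 * U * R / √(μ * R) := by positivity
    simp only [pow_zero, mul_one] at hL ⊢
    norm_num
    linarith
  | succ k ih =>
    intro L hL hL1 h1 h2
    set w := √(μ * R) with hwd
    set P : ℝ := 2 ^ k with hP
    have hP0 : 1 ≤ P := one_le_pow₀ (by norm_num)
    have hP4 : (4 : ℝ) ^ k = P * P := by rw [hP, ← mul_pow]; norm_num
    have hUR : 0 ≤ 40 * U * R / w := by positivity
    have hpp : (2 : ℝ) ^ (k + 1) = 2 * P := by rw [pow_succ]; ring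
    rw [hpp]
    have hinv : 1 / (2 * P) = 1 / P / 2 := by field_simp
    have hw40 : 0 ≤ 40 / w := by positivity
    have hPi : 0 ≤ 1 / P := by positivity
    rw [hinv]
    by_cases hc : (L : ℝ) ≤ R * 4 ^ k
    · refine (ih L hc hL1 h1 h2).trans ?_
      nlinarith
    · push Not at hc
      set m := ⌊R * 4 ^ k⌋₊ with hm
      have hRP : 1 ≤ R * 4 ^ k := by rw [hP4]; nlinarith
      have hm1 : (m : ℝ) ≤ R * 4 ^ k := Nat.floor_le (by positivity)
      have hm2 : R * 4 ^ k < m + 1 := Nat.lt_floor_add_one _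
      have hm3 : 1 ≤ m := Nat.le_floor (by simpa using hRP)
      have hm3' : (1 : ℝ) ≤ m := by exact_mod_cast hm3
      have hmL : m < L := by
        have : (m : ℝ) < L := hm1.trans_lt hc
        exact_mod_cast this
      have hmL' : (m : ℝ) ≤ L := by exact_mod_cast hmL.le
      have hlow := ih m hm1 (by nlinarith) (fun n hn ↦ h1 n (by omega))
        (fun n hn ↦ h2 n (by omega))
      have hblock := norm_sum_e_le_of_secondDiff (fun n ↦ g (m + n)) (L - m) (l := μ * m) (U := U)
        (by positivity) (by nlinarith) hU
        (fun n hn ↦ by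
          have := h1 (m + n) (by omega)
          push_cast at this
          have h0 : 0 ≤ μ * n := by positivity
          simp only [← add_assoc] at this ⊢
          linarith)
        (fun n hn ↦ h2 (m + n) (by omega))
      have hs : w * P / 2 ≤ √(μ * m) := by
        apply le_sqrt_of_sq_le
        have : w ^ 2 = μ * R := sq_sqrt (by positivity)
        rw [div_pow, mul_pow, this]
        rw [hP4] at hm2
        have : R * (P * P) ≤ 4 * m := by linarith
        nlinarith
      have hb2 : (U * ((L - m : ℕ) : ℝ) + 2) * (5 / √(μ * m)) ≤
          (U * (4 * (R * (P * P))) + 2) * (10 / (w * P)) := by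
        apply mul_le_mul _ _ (by positivity) (by positivity)
        · have : ((L - m : ℕ) : ℝ) ≤ 4 * (R * (P * P)) := by
            have h : ((L - m : ℕ) : ℝ) ≤ L := by exact_mod_cast Nat.sub_le _ _
            rw [pow_succ, hP4] at hL
            linarith
          have := mul_le_mul_of_nonneg_left this hU
          linarith
        · have : 10 / (w * P) = 5 / (w * P / 2) := by field_simp; norm_num
          rw [this]
          exact div_le_div_of_nonneg_left (by norm_num) (by positivity) hs
      have hb3 : (U * (4 * (R * (P * P))) + 2) * (10 / (w * P)) =
          40 * U * R / w * P + 40 / w * (1 / P / 2) := by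
        field_simp; ring
      have hsum : ∑ n ∈ range L, e (g n) =
          ∑ n ∈ range m, e (g n) + ∑ n ∈ range (L - m), e (g (m + n)) := by
        rw [← sum_range_add (fun n ↦ e (g n)), Nat.add_sub_cancel' hmL.le]
      rw [hsum]
      refine (norm_add_le _ _).trans ?_
      linarith

/-- Exponential sums whose second differences grow at least linearly, as they do to one side of a
simple zero of the second derivative. The first `R` terms are estimated trivially. -/
lemma norm_sum_e_le_of_secondDiff_ge_linear (g : ℕ → ℝ) {μ U R X : ℝ} (hμ : 0 < μ) (hU : 0 ≤ U)
    (hR : 1 ≤ R) (hRX : R ≤ X) (L : ℕ) (hLX : (L : ℝ) ≤ X) (hL1 : μ * L ≤ 1)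
    (h1 : ∀ n, n + 1 < L → μ * n ≤ g (n + 2) - 2 * g (n + 1) + g n)
    (h2 : ∀ n, n + 1 < L → g (n + 2) - 2 * g (n + 1) + g n ≤ U) :
    ‖∑ n ∈ range L, e (g n)‖ ≤ R + 80 * U * √(X / μ) + 40 / √(μ * R) := by
  have hR0 : 0 < R := by linarith
  have hX0 : 0 < X := by linarith
  have hw : 0 < √(μ * R) := sqrt_pos.mpr (by positivity)
  obtain ⟨n, hn1, hn2⟩ := exists_nat_pow_near (x := X / R) (y := (4 : ℝ))
    (by rw [le_div_iff₀ hR0]; linarith) (by norm_num)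
  rw [div_lt_iff₀ hR0] at hn2
  rw [le_div_iff₀ hR0] at hn1
  have h := norm_sum_e_le_of_secondDiff_ge_linear_aux g hμ hU hR (n + 1) L (by linarith) hL1 h1 h2
  refine h.trans ?_
  have a1 : 40 / √(μ * R) * (1 - 1 / 2 ^ (n + 1)) ≤ 40 / √(μ * R) := by
    have : (0 : ℝ) ≤ 1 / 2 ^ (n + 1) := by positivity
    have h40 : 0 ≤ 40 / √(μ * R) := by positivity
    nlinarith
  have a2 : R * 2 ^ n ≤ √(X / μ) * √(μ * R) := by
    rw [← sqrt_mul (by positivity)]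
    apply le_sqrt_of_sq_le
    have e1 : X / μ * (μ * R) = X * R := by field_simp
    have e2 : (R * 2 ^ n) ^ 2 = (4 ^ n * R) * R := by
      rw [mul_pow, ← pow_mul, mul_comm n 2, pow_mul]; norm_num; ring
    rw [e1, e2]
    exact mul_le_mul_of_nonneg_right hn1 hR0.le
  have a3 : 40 * U * R / √(μ * R) * 2 ^ (n + 1) ≤ 80 * U * √(X / μ) := by
    rw [div_mul_eq_mul_div, div_le_iff₀ hw, pow_succ]
    have := mul_le_mul_of_nonneg_left a2 (show 0 ≤ 80 * U by positivity)
    linarith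
  linarith

/-! ### From second derivatives to second differences -/

lemma norm_sum_e_neg (g : ℕ → ℝ) (s : Finset ℕ) : ‖∑ n ∈ s, e (-g n)‖ = ‖∑ n ∈ s, e (g n)‖ := by
  simp_rw [e_neg]
  rw [← map_sum, RCLike.norm_conj]

lemma exists_secondDiff_eq {F F₁ F₂ : ℝ → ℝ}
    (h₁ : ∀ x ∈ Set.Icc (0 : ℝ) 1, HasDerivWithinAt F (F₁ x) (Set.Icc 0 1) x)
    (h₂ : ∀ x ∈ Set.Icc (0 : ℝ) 1, HasDerivWithinAt F₁ (F₂ x) (Set.Icc 0 1) x)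
    {x h : ℝ} (hx : x ∈ Set.Icc (0 : ℝ) 1) (hxh : x + 2 * h ∈ Set.Icc (0 : ℝ) 1) :
    ∃ t ∈ Set.Icc (0 : ℝ) 2, F (x + 2 * h) - 2 * F (x + h) + F x = h ^ 2 * F₂ (x + t * h) := by
  have hmem : ∀ t ∈ Set.Icc (0 : ℝ) 2, x + t * h ∈ Set.Icc (0 : ℝ) 1 := by
    intro t ht
    obtain ⟨ht0, ht2⟩ := ht
    obtain ⟨a, b⟩ := hx
    obtain ⟨a', b'⟩ := hxh
    constructor <;> nlinarith
  have key : ∀ G G' : ℝ → ℝ,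
      (∀ x ∈ Set.Icc (0 : ℝ) 1, HasDerivWithinAt G (G' x) (Set.Icc 0 1) x) →
      ∀ t ∈ Set.Icc (0 : ℝ) 2,
        HasDerivWithinAt (fun t ↦ G (x + t * h)) (G' (x + t * h) * h) (Set.Icc 0 2) t := by
    intro G G' hG t ht
    have hl : HasDerivWithinAt (fun t : ℝ ↦ x + t * h) h (Set.Icc 0 2) t := by
      simpa using ((hasDerivAt_id t).mul_const h).const_add x |>.hasDerivWithinAt
    exact (hG _ (hmem t ht)).comp t hl hmem
  have k1 := key F F₁ h₁
  have k2 := key F₁ F₂ h₂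
  -- the mean value theorem for `t ↦ F (x + (t + 1) h) - F (x + t h)` on `[0, 1]`
  have d1 : ∀ t ∈ Set.Icc (0 : ℝ) 1,
      HasDerivWithinAt (fun t ↦ F (x + (t + 1) * h) - F (x + t * h))
        (F₁ (x + (t + 1) * h) * h - F₁ (x + t * h) * h) (Set.Icc 0 1) t := by
    intro t ht
    have a := k1 (t + 1) ⟨by linarith [ht.1], by linarith [ht.2]⟩
    have b := (k1 t ⟨ht.1, by linarith [ht.2]⟩).mono
      (Set.Icc_subset_Icc_right (by norm_num : (1 : ℝ) ≤ 2))
    have hl : HasDerivWithinAt (fun t : ℝ ↦ t + 1) 1 (Set.Icc 0 1) t :=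
      ((hasDerivAt_id t).add_const 1).hasDerivWithinAt
    have hmaps : Set.MapsTo (fun t : ℝ ↦ t + 1) (Set.Icc 0 1) (Set.Icc 0 2) :=
      fun s hs ↦ ⟨by linarith [hs.1], by linarith [hs.2]⟩
    have a' := HasDerivWithinAt.comp (h₂ := fun t ↦ F (x + t * h)) t a hl hmaps
    rw [mul_one] at a'
    exact a'.sub b
  obtain ⟨τ, hτ, hτe⟩ := exists_hasDerivAt_eq_slope
    (fun t ↦ F (x + (t + 1) * h) - F (x + t * h))
    (fun t ↦ F₁ (x + (t + 1) * h) * h - F₁ (x + t * h) * h) zero_lt_one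
    (fun t ht ↦ (d1 t ht).continuousWithinAt)
    (fun t ht ↦ (d1 t (Set.Ioo_subset_Icc_self ht)).hasDerivAt (Icc_mem_nhds ht.1 ht.2))
  obtain ⟨t, ht, hte⟩ := exists_hasDerivAt_eq_slope
    (fun t ↦ F₁ (x + t * h)) (fun t ↦ F₂ (x + t * h) * h) (lt_add_one τ)
    (fun t ht ↦ ((k2 t ⟨by linarith [hτ.1, ht.1], by linarith [hτ.2, ht.2]⟩).mono
      (Set.Icc_subset_Icc hτ.1.le (by linarith [hτ.2]))).continuousWithinAt)
    (fun t ht ↦ (k2 t ⟨by linarith [hτ.1, ht.1], by linarith [hτ.2, ht.2]⟩).hasDerivAt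
      (Icc_mem_nhds (by linarith [hτ.1, ht.1]) (by linarith [hτ.2, ht.2])))
  refine ⟨t, ⟨by linarith [hτ.1, ht.1], by linarith [hτ.2, ht.2]⟩, ?_⟩
  have e1 : x + (1 + 1) * h = x + 2 * h := by ring
  have e2 : x + (0 + 1) * h = x + h := by ring
  have e3 : x + 1 * h = x + h := by ring
  have e4 : x + 0 * h = x := by ring
  simp only [e1, e2, e3, e4, sub_zero, div_one] at hτe
  simp only [add_sub_cancel_left, div_one] at hte
  linear_combination -hτe - h * hte

/-- The exponential sum over an arithmetic progression that moves away from a point `x₀` near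
which `F₂ = F''` is at least linearly large. The step `h` may be negative. -/
lemma norm_sum_e_le_of_away {F F₁ F₂ : ℝ → ℝ}
    (h₁ : ∀ x ∈ Set.Icc (0 : ℝ) 1, HasDerivWithinAt F (F₁ x) (Set.Icc 0 1) x)
    (h₂ : ∀ x ∈ Set.Icc (0 : ℝ) 1, HasDerivWithinAt F₁ (F₂ x) (Set.Icc 0 1) x)
    {q κ B R X x₀ y h σ : ℝ} (hq : 0 < q) (hκ : 0 < κ) (hB : 0 ≤ B) (hR : 1 ≤ R) (hRX : R ≤ X)
    (hXκ : κ * X ≤ q ^ 2) (hh : |h| = 1 / q) (hσ : σ = 1 ∨ σ = -1) {S : Set ℝ}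
    (hS : S.OrdConnected) (hSI : S ⊆ Set.Icc 0 1)
    (hbd : ∀ x ∈ S, |F₂ x| ≤ B) (hlow : ∀ x ∈ S, κ * |x - x₀| ≤ σ * F₂ x)
    (hy : 0 ≤ (y - x₀) * h) {m : ℕ} (hm : ((m + 1 : ℕ) : ℝ) ≤ X)
    (hS0 : y ∈ S) (hSm : y + m * h ∈ S) :
    ‖∑ n ∈ range (m + 1), e (q * F (y + n * h))‖ ≤
      1 + (R + 80 * (B / q) * √(X / (κ / q ^ 2)) + 40 / √(κ / q ^ 2 * R)) := by
  have hmem : ∀ t : ℝ, 0 ≤ t → t ≤ m → y + t * h ∈ S := by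
    intro t h0 htm
    rcases le_total 0 h with hh | hh
    · exact hS.out hS0 hSm ⟨by nlinarith, by nlinarith⟩
    · exact hS.out hSm hS0 ⟨by nlinarith, by nlinarith⟩
  have hhq : h ^ 2 = 1 / q ^ 2 := by rw [← sq_abs, hh]; field_simp
  have hh0 : 0 < |h| := by rw [hh]; positivity
  have hsd : ∀ n, n + 1 < m → ∃ t ∈ Set.Icc (0 : ℝ) 2, y + (n + t) * h ∈ S ∧
      q * F (y + (n + 2 : ℕ) * h) - 2 * (q * F (y + (n + 1 : ℕ) * h)) + q * F (y + n * h) =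
        F₂ (y + (n + t) * h) / q := by
    intro n hn
    have hnm : (n : ℝ) + 2 ≤ m := by exact_mod_cast (by omega : n + 2 ≤ m)
    have e1 : y + n * h + 2 * h = y + (n + 2 : ℕ) * h := by push_cast; ring
    have e2 : y + n * h + h = y + (n + 1 : ℕ) * h := by push_cast; ring
    obtain ⟨t, ht, hte⟩ := exists_secondDiff_eq h₁ h₂ (x := y + n * h) (h := h)
      (hSI (hmem n (by positivity) (by linarith)))
      (by rw [e1]; exact hSI (hmem _ (by positivity) (by push_cast; linarith)))
    refine ⟨t, ht, hmem _ (by linarith [ht.1, (Nat.cast_nonneg n : (0 : ℝ) ≤ n)])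
      (by linarith [ht.2]), ?_⟩
    rw [e1, e2, hhq, show y + n * h + t * h = y + (n + t) * h by ring] at hte
    have : q * F (y + (n + 2 : ℕ) * h) - 2 * (q * F (y + (n + 1 : ℕ) * h)) + q * F (y + n * h) =
      q * (F (y + (n + 2 : ℕ) * h) - 2 * F (y + (n + 1 : ℕ) * h) + F (y + n * h)) := by ring
    rw [this, hte]
    field_simp
  have hfar : ∀ n : ℕ, ∀ t ∈ Set.Icc (0 : ℝ) 2, n / q ≤ |y + (n + t) * h - x₀| := by
    intro n t ht
    have : (n : ℝ) * h ^ 2 ≤ |y + (n + t) * h - x₀| * |h| := by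
      rw [← abs_mul]
      refine le_trans ?_ (le_abs_self _)
      have : 0 ≤ t * h ^ 2 := mul_nonneg ht.1 (sq_nonneg h)
      nlinarith
    rw [← sq_abs, sq, ← mul_assoc] at this
    have := le_of_mul_le_mul_right this hh0
    rwa [hh, mul_one_div] at this
  have main : ‖∑ n ∈ range m, e (σ * (q * F (y + n * h)))‖ ≤
      R + 80 * (B / q) * √(X / (κ / q ^ 2)) + 40 / √(κ / q ^ 2 * R) := by
    have hmX : (m : ℝ) ≤ X := by push_cast at hm; linarith
    refine norm_sum_e_le_of_secondDiff_ge_linear (fun n ↦ σ * (q * F (y + n * h)))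
      (by positivity) (by positivity) hR hRX m hmX ?_ ?_ ?_
    · rw [div_mul_eq_mul_div, div_le_one (by positivity)]
      exact (mul_le_mul_of_nonneg_left hmX hκ.le).trans hXκ
    · intro n hn
      obtain ⟨t, ht, htS, hte⟩ := hsd n hn
      have e1 : σ * (q * F (y + (n + 2 : ℕ) * h)) - 2 * (σ * (q * F (y + (n + 1 : ℕ) * h))) +
          σ * (q * F (y + n * h)) = σ * F₂ (y + (n + t) * h) / q := by
        linear_combination σ * hte
      rw [e1, le_div_iff₀ hq]
      refine le_trans ?_ (hlow _ htS)
      refine le_trans (le_of_eq ?_) (mul_le_mul_of_nonneg_left (hfar n t ht) hκ.le)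
      field_simp
    · intro n hn
      obtain ⟨t, ht, htS, hte⟩ := hsd n hn
      have e1 : σ * (q * F (y + (n + 2 : ℕ) * h)) - 2 * (σ * (q * F (y + (n + 1 : ℕ) * h))) +
          σ * (q * F (y + n * h)) = σ * F₂ (y + (n + t) * h) / q := by
        linear_combination σ * hte
      rw [e1]
      refine div_le_div_of_nonneg_right ?_ hq.le
      have := abs_le.mp (hbd _ htS)
      rcases hσ with rfl | rfl <;> linarith
  rw [sum_range_succ, add_comm]
  refine (norm_add_le _ _).trans ?_
  rw [norm_e]
  refine add_le_add_right (le_trans (le_of_eq ?_) main) _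
  rcases hσ with rfl | rfl
  · simp
  · rw [← norm_sum_e_neg]; simp

/-- If `F₂` or its derivative `F₃` is at least `c` on `[u, v]`, then `F₂` grows at least linearly,
and with a fixed sign, on either side of some point of `[u, v]`. -/
lemma exists_signed_lower_bound_of_le {F₂ F₃ : ℝ → ℝ} {c u v : ℝ} (hc : 0 < c) (hu : 0 ≤ u)
    (huv : u ≤ v) (hv : v ≤ 1)
    (h₃ : ∀ x ∈ Set.Icc (0 : ℝ) 1, HasDerivWithinAt F₂ (F₃ x) (Set.Icc 0 1) x)
    (h : (∀ x ∈ Set.Icc u v, c ≤ F₂ x) ∨ (∀ x ∈ Set.Icc u v, c ≤ F₃ x)) :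
    ∃ x₀ ∈ Set.Icc u v, ∃ σ₁ σ₂ : ℝ, (σ₁ = 1 ∨ σ₁ = -1) ∧ (σ₂ = 1 ∨ σ₂ = -1) ∧
      (∀ x ∈ Set.Icc u x₀, c * |x - x₀| ≤ σ₁ * F₂ x) ∧
      (∀ x ∈ Set.Icc x₀ v, c * |x - x₀| ≤ σ₂ * F₂ x) := by
  rcases h with h | h
  · have hle : ∀ x ∈ Set.Icc u v, c * |x - u| ≤ 1 * F₂ x := by
      intro x hx
      rw [abs_of_nonneg (by linarith [hx.1])]
      have := h x hx
      have h1 : x - u ≤ 1 := by linarith [hx.2]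
      nlinarith
    refine ⟨u, ⟨le_rfl, huv⟩, 1, 1, Or.inl rfl, Or.inl rfl, fun x hx ↦ hle x ⟨hx.1, hx.2.trans huv⟩,
      hle⟩
  · have hsub : Set.Icc u v ⊆ Set.Icc (0 : ℝ) 1 := Set.Icc_subset_Icc hu hv
    have hcont : ContinuousOn F₂ (Set.Icc u v) := fun x hx ↦
      ((h₃ x (hsub hx)).mono hsub).continuousWithinAt
    have hinc : ∀ x ∈ Set.Icc u v, ∀ y ∈ Set.Icc u v, x ≤ y → c * (y - x) ≤ F₂ y - F₂ x := by
      refine Convex.mul_sub_le_image_sub_of_le_deriv (convex_Icc u v) hcont ?_ ?_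
      · intro x hx
        exact ((h₃ x (hsub (interior_subset hx))).mono hsub).differentiableWithinAt.mono
          interior_subset
      · intro x hx
        rw [interior_Icc] at hx
        have := (h₃ x (hsub (Set.Ioo_subset_Icc_self hx))).hasDerivAt
          (Icc_mem_nhds (by linarith [hx.1]) (by linarith [hx.2]))
        rw [this.deriv]
        exact h x (Set.Ioo_subset_Icc_self hx)
    have hu' : u ∈ Set.Icc u v := ⟨le_rfl, huv⟩
    have hv' : v ∈ Set.Icc u v := ⟨huv, le_rfl⟩
    have fin : ∀ x₀ ∈ Set.Icc u v, (u < x₀ → F₂ x₀ ≤ 0) → (x₀ < v → 0 ≤ F₂ x₀) →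
        ∃ σ₁ σ₂ : ℝ, (σ₁ = 1 ∨ σ₁ = -1) ∧ (σ₂ = 1 ∨ σ₂ = -1) ∧
      (∀ x ∈ Set.Icc u x₀, c * |x - x₀| ≤ σ₁ * F₂ x) ∧
      (∀ x ∈ Set.Icc x₀ v, c * |x - x₀| ≤ σ₂ * F₂ x) := by
      intro x₀ hx₀ ha hb
      have sgn : ∃ σ : ℝ, (σ = 1 ∨ σ = -1) ∧ 0 ≤ σ * F₂ x₀ := by
        rcases le_total 0 (F₂ x₀) with h | h
        · exact ⟨1, Or.inl rfl, by linarith⟩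
        · exact ⟨-1, Or.inr rfl, by linarith⟩
      obtain ⟨σ, hσ, hσ0⟩ := sgn
      refine ⟨if u < x₀ then -1 else σ, if x₀ < v then 1 else σ, ?_, ?_, ?_, ?_⟩
      · split_ifs
        · exact Or.inr rfl
        · exact hσ
      · split_ifs
        · exact Or.inl rfl
        · exact hσ
      · intro x hx
        split_ifs with h0
        · have := hinc x ⟨hx.1, hx.2.trans hx₀.2⟩ x₀ hx₀ hx.2
          rw [abs_of_nonpos (by linarith [hx.2])]
          linarith [ha h0]
        · have : x = x₀ := le_antisymm hx.2 (by linarith [hx.1])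
          subst this
          simpa using hσ0
      · intro x hx
        split_ifs with h0
        · have := hinc x₀ hx₀ x ⟨hx₀.1.trans hx.1, hx.2⟩ hx.1
          rw [abs_of_nonneg (by linarith [hx.1])]
          linarith [hb h0]
        · have : x = x₀ := le_antisymm (by linarith [hx.2]) hx.1
          subst this
          simpa using hσ0
    rcases le_total 0 (F₂ u) with h0 | h0
    · exact ⟨u, hu', fin u hu' (fun h ↦ absurd h (lt_irrefl _)) (fun _ ↦ h0)⟩
    rcases le_total (F₂ v) 0 with h1 | h1
    · exact ⟨v, hv', fin v hv' (fun _ ↦ h1) (fun h ↦ absurd h (lt_irrefl _))⟩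
    obtain ⟨x₀, hx₀, hz⟩ := intermediate_value_Icc huv hcont ⟨h0, h1⟩
    exact ⟨x₀, hx₀, fin x₀ hx₀ (fun _ ↦ hz.le) (fun _ ↦ hz.ge)⟩

lemma exists_signed_lower_bound {F₂ F₃ : ℝ → ℝ} {c u v τ : ℝ} (hc : 0 < c) (hu : 0 ≤ u)
    (huv : u ≤ v) (hv : v ≤ 1) (hτ : τ = 1 ∨ τ = -1)
    (h₃ : ∀ x ∈ Set.Icc (0 : ℝ) 1, HasDerivWithinAt F₂ (F₃ x) (Set.Icc 0 1) x)
    (h : (∀ x ∈ Set.Icc u v, c ≤ τ * F₂ x) ∨ (∀ x ∈ Set.Icc u v, c ≤ τ * F₃ x)) :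
    ∃ x₀ ∈ Set.Icc u v, ∃ σ₁ σ₂ : ℝ, (σ₁ = 1 ∨ σ₁ = -1) ∧ (σ₂ = 1 ∨ σ₂ = -1) ∧
      (∀ x ∈ Set.Icc u x₀, c * |x - x₀| ≤ σ₁ * F₂ x) ∧
      (∀ x ∈ Set.Icc x₀ v, c * |x - x₀| ≤ σ₂ * F₂ x) := by
  obtain ⟨x₀, hx₀, σ₁, σ₂, h1, h2, h3, h4⟩ := exists_signed_lower_bound_of_le
    (F₂ := fun x ↦ τ * F₂ x) (F₃ := fun x ↦ τ * F₃ x) hc hu huv hv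
    (fun x hx ↦ (h₃ x hx).const_mul τ) h
  have hmul : ∀ σ : ℝ, (σ = 1 ∨ σ = -1) → (σ * τ = 1 ∨ σ * τ = -1) := by
    rintro σ (rfl | rfl) <;> rcases hτ with rfl | rfl <;> norm_num
  refine ⟨x₀, hx₀, σ₁ * τ, σ₂ * τ, hmul σ₁ h1, hmul σ₂ h2, ?_, ?_⟩
  · intro x hx; rw [mul_assoc]; exact h3 x hx
  · intro x hx; rw [mul_assoc]; exact h4 x hx

/-- The exponential sum over the `n` with `n / q ∈ [u, v)`, cut at the point near which `F''` may
be small. -/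
lemma norm_sum_e_piece_le {F F₁ F₂ : ℝ → ℝ}
    (h₁ : ∀ x ∈ Set.Icc (0 : ℝ) 1, HasDerivWithinAt F (F₁ x) (Set.Icc 0 1) x)
    (h₂ : ∀ x ∈ Set.Icc (0 : ℝ) 1, HasDerivWithinAt F₁ (F₂ x) (Set.Icc 0 1) x)
    {q κ B R X u v x₀ σ₁ σ₂ : ℝ} (hq : 0 < q) (hκ : 0 < κ) (hB : 0 ≤ B) (hR : 1 ≤ R) (hRX : R ≤ X)
    (hXκ : κ * X ≤ q ^ 2) (hu : 0 ≤ u) (hv : v ≤ 1) (hx₀ : x₀ ∈ Set.Icc u v)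
    (hσ₁ : σ₁ = 1 ∨ σ₁ = -1) (hσ₂ : σ₂ = 1 ∨ σ₂ = -1)
    (hbd : ∀ x ∈ Set.Icc u v, |F₂ x| ≤ B)
    (hlow₁ : ∀ x ∈ Set.Icc u x₀, κ * |x - x₀| ≤ σ₁ * F₂ x)
    (hlow₂ : ∀ x ∈ Set.Icc x₀ v, κ * |x - x₀| ≤ σ₂ * F₂ x)
    (s : Finset ℕ) (hs : (s : Set ℕ).OrdConnected) (hsX : (s.card : ℝ) ≤ X)
    (hsuv : ∀ n ∈ s, (n : ℝ) / q ∈ Set.Icc u v) :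
    ‖∑ n ∈ s, e (q * F (n / q))‖ ≤
      2 * (1 + (R + 80 * (B / q) * √(X / (κ / q ^ 2)) + 40 / √(κ / q ^ 2 * R))) := by
  set E := 1 + (R + 80 * (B / q) * √(X / (κ / q ^ 2)) + 40 / √(κ / q ^ 2 * R)) with hE
  have hE0 : 0 ≤ E := by
    have : 0 ≤ R := by linarith
    positivity
  have hordl : ((s.filter fun n : ℕ ↦ (n : ℝ) / q < x₀) : Set ℕ).OrdConnected := by
    refine ⟨fun n hn m hm i hi ↦ ?_⟩
    simp only [coe_filter, Set.mem_ofPred_eq] at hn hm ⊢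
    refine ⟨hs.out hn.1 hm.1 hi, lt_of_le_of_lt ?_ hm.2⟩
    exact div_le_div_of_nonneg_right (by exact_mod_cast hi.2) hq.le
  have hordr : ((s.filter fun n : ℕ ↦ ¬ (n : ℝ) / q < x₀) : Set ℕ).OrdConnected := by
    refine ⟨fun n hn m hm i hi ↦ ?_⟩
    simp only [coe_filter, Set.mem_ofPred_eq, not_lt] at hn hm ⊢
    refine ⟨hs.out hn.1 hm.1 hi, le_trans hn.2 ?_⟩
    exact div_le_div_of_nonneg_right (by exact_mod_cast hi.1) hq.le
  have left : ‖∑ n ∈ s.filter fun n : ℕ ↦ (n : ℝ) / q < x₀, e (q * F (n / q))‖ ≤ E := by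
    have hcard : ((s.filter fun n : ℕ ↦ (n : ℝ) / q < x₀).card : ℝ) ≤ X :=
      le_trans (by exact_mod_cast card_filter_le _ _) hsX
    have hmem : ∀ n ∈ (s.filter fun n : ℕ ↦ (n : ℝ) / q < x₀), (n : ℝ) / q ∈ Set.Icc u x₀ :=
      fun n hn ↦ ⟨(hsuv n (mem_filter.mp hn).1).1, (mem_filter.mp hn).2.le⟩
    obtain ⟨a, b, hab, hset⟩ := exists_eq_Ico_of_ordConnected _ hordl
    rw [hset] at hcard hmem ⊢
    rcases hab.eq_or_lt with rfl | hab
    · simpa using hE0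
    obtain ⟨m, rfl⟩ := Nat.exists_eq_add_of_lt hab
    have hlast := hmem (a + m) (by simp)
    have hfirst := hmem a (by simp)
    rw [sum_Ico_eq_sum_range, show a + m + 1 - a = m + 1 by omega, ← sum_range_reflect]
    have hpt : ∀ n ∈ range (m + 1), e (q * F (((a + (m + 1 - 1 - n) : ℕ) : ℝ) / q)) =
        e (q * F (((a + m : ℕ) : ℝ) / q + n * (-(1 / q)))) := by
      intro n hn
      have hn : n ≤ m := by simpa [Nat.lt_succ_iff] using hn
      congr 3
      rw [show a + (m + 1 - 1 - n) = a + m - n by omega, Nat.cast_sub (by omega)]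
      ring
    rw [sum_congr rfl hpt]
    refine norm_sum_e_le_of_away h₁ h₂ hq hκ hB hR hRX hXκ (σ := σ₁) (x₀ := x₀) (S := Set.Icc u x₀)
      (by rw [abs_neg, abs_of_pos (by positivity)]) hσ₁ Set.ordConnected_Icc
      (Set.Icc_subset_Icc hu (hx₀.2.trans hv)) (fun x hx ↦ hbd x ⟨hx.1, hx.2.trans hx₀.2⟩) hlow₁
      ?_ ?_ hlast ?_
    · exact mul_nonneg_of_nonpos_of_nonpos (by linarith [hlast.2])
        (by rw [neg_nonpos]; positivity)
    · rw [Nat.card_Ico, show a + m + 1 - a = m + 1 by omega] at hcard; exact hcard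
    · convert hfirst using 1
      push_cast; field_simp; ring
  have right : ‖∑ n ∈ s.filter fun n : ℕ ↦ ¬ (n : ℝ) / q < x₀, e (q * F (n / q))‖ ≤ E := by
    have hcard : ((s.filter fun n : ℕ ↦ ¬ (n : ℝ) / q < x₀).card : ℝ) ≤ X :=
      le_trans (by exact_mod_cast card_filter_le _ _) hsX
    have hmem : ∀ n ∈ (s.filter fun n : ℕ ↦ ¬ (n : ℝ) / q < x₀), (n : ℝ) / q ∈ Set.Icc x₀ v :=
      fun n hn ↦ ⟨not_lt.mp (mem_filter.mp hn).2, (hsuv n (mem_filter.mp hn).1).2⟩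
    obtain ⟨a, b, hab, hset⟩ := exists_eq_Ico_of_ordConnected _ hordr
    rw [hset] at hcard hmem ⊢
    rcases hab.eq_or_lt with rfl | hab
    · simpa using hE0
    obtain ⟨m, rfl⟩ := Nat.exists_eq_add_of_lt hab
    have hlast := hmem (a + m) (by simp)
    have hfirst := hmem a (by simp)
    rw [sum_Ico_eq_sum_range, show a + m + 1 - a = m + 1 by omega]
    have hpt : ∀ n ∈ range (m + 1), e (q * F (((a + n : ℕ) : ℝ) / q)) =
        e (q * F ((a : ℝ) / q + n * (1 / q))) := by
      intro n hn
      congr 3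
      push_cast; field_simp
    rw [sum_congr rfl hpt]
    refine norm_sum_e_le_of_away h₁ h₂ hq hκ hB hR hRX hXκ (σ := σ₂) (x₀ := x₀) (S := Set.Icc x₀ v)
      (abs_of_pos (by positivity)) hσ₂ Set.ordConnected_Icc
      (Set.Icc_subset_Icc (hu.trans hx₀.1) hv) (fun x hx ↦ hbd x ⟨hx₀.1.trans hx.1, hx.2⟩) hlow₂
      ?_ ?_ hfirst ?_
    · exact mul_nonneg (by linarith [hfirst.1]) (by positivity)
    · rw [Nat.card_Ico, show a + m + 1 - a = m + 1 by omega] at hcard; exact hcard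
    · convert hlast using 1
      push_cast; field_simp
  rw [← sum_filter_add_sum_filter_not s (fun n : ℕ ↦ (n : ℝ) / q < x₀)]
  exact (norm_add_le _ _).trans (by linarith)

/-! ### Uniform nondegeneracy from nonvanishing torsion -/

/-- Uniform nondegeneracy: if `(a₂, a₃)` and `(b₂, b₃)` are linearly independent at each point of
`[0, 1]`, then on any sufficiently short interval one of the combinations `j₁ a₂ + j₂ b₂`,
`j₁ a₃ + j₂ b₃` keeps its sign and is comparable to `max |j₁| |j₂|`. -/
lemma exists_uniform_lower_bound {a₂ a₃ b₂ b₃ : ℝ → ℝ}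
    (ha₂ : ContinuousOn a₂ (Set.Icc 0 1)) (ha₃ : ContinuousOn a₃ (Set.Icc 0 1))
    (hb₂ : ContinuousOn b₂ (Set.Icc 0 1)) (hb₃ : ContinuousOn b₃ (Set.Icc 0 1))
    (hdet : ∀ x ∈ Set.Icc (0 : ℝ) 1, a₂ x * b₃ x - b₂ x * a₃ x ≠ 0) :
    ∃ c B : ℝ, ∃ M : ℕ, 0 < c ∧ 0 < B ∧ 0 < M ∧ ∀ j₁ j₂ J : ℝ, 0 < J → max |j₁| |j₂| = J →
      (∀ x ∈ Set.Icc (0 : ℝ) 1, |j₁ * a₂ x + j₂ * b₂ x| ≤ B * J) ∧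
      ∀ u v : ℝ, 0 ≤ u → u ≤ v → v ≤ 1 → v - u ≤ 1 / M → ∃ τ : ℝ, (τ = 1 ∨ τ = -1) ∧
        ((∀ x ∈ Set.Icc u v, c * J ≤ τ * (j₁ * a₂ x + j₂ * b₂ x)) ∨
          (∀ x ∈ Set.Icc u v, c * J ≤ τ * (j₁ * a₃ x + j₂ * b₃ x))) := by
  have hI : IsCompact (Set.Icc (0 : ℝ) 1) := isCompact_Icc
  have bound : ∀ a : ℝ → ℝ, ContinuousOn a (Set.Icc 0 1) →
      ∃ B : ℝ, 0 < B ∧ ∀ x ∈ Set.Icc (0 : ℝ) 1, |a x| ≤ B := by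
    intro a ha
    obtain ⟨B, hB⟩ := hI.exists_bound_of_continuousOn ha
    exact ⟨max B 1, by positivity, fun x hx ↦ (hB x hx).trans (le_max_left _ _)⟩
  obtain ⟨B, hB0, hBa₂, hBa₃, hBb₂, hBb₃⟩ : ∃ B : ℝ, 0 < B ∧
      (∀ x ∈ Set.Icc (0 : ℝ) 1, |a₂ x| ≤ B) ∧ (∀ x ∈ Set.Icc (0 : ℝ) 1, |a₃ x| ≤ B) ∧
      (∀ x ∈ Set.Icc (0 : ℝ) 1, |b₂ x| ≤ B) ∧ (∀ x ∈ Set.Icc (0 : ℝ) 1, |b₃ x| ≤ B) := by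
    obtain ⟨B₁, h1, h1'⟩ := bound a₂ ha₂
    obtain ⟨B₂, h2, h2'⟩ := bound a₃ ha₃
    obtain ⟨B₃, h3, h3'⟩ := bound b₂ hb₂
    obtain ⟨B₄, h4, h4'⟩ := bound b₃ hb₃
    exact ⟨B₁ + B₂ + B₃ + B₄, by positivity, fun x hx ↦ by linarith [h1' x hx],
      fun x hx ↦ by linarith [h2' x hx], fun x hx ↦ by linarith [h3' x hx],
      fun x hx ↦ by linarith [h4' x hx]⟩
  obtain ⟨D, hD0, hD⟩ : ∃ D : ℝ, 0 < D ∧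
      ∀ x ∈ Set.Icc (0 : ℝ) 1, D ≤ |a₂ x * b₃ x - b₂ x * a₃ x| := by
    obtain ⟨x, hx, hmin⟩ := hI.exists_isMinOn (Set.nonempty_Icc.mpr zero_le_one)
      ((ha₂.mul hb₃).sub (hb₂.mul ha₃)).abs
    exact ⟨_, abs_pos.mpr (hdet x hx), fun y hy ↦ hmin hy⟩
  set c := D / (8 * B) with hc
  have hc0 : 0 < c := by positivity
  have unif : ∀ a : ℝ → ℝ, ContinuousOn a (Set.Icc 0 1) → ∃ η : ℝ, 0 < η ∧
      ∀ x ∈ Set.Icc (0 : ℝ) 1, ∀ y ∈ Set.Icc (0 : ℝ) 1, |x - y| < η → |a x - a y| ≤ c / 2 := by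
    intro a ha
    obtain ⟨η, h1, h2⟩ := Metric.uniformContinuousOn_iff.mp
      (hI.uniformContinuousOn_of_continuous ha) (c / 2) (by positivity)
    exact ⟨η, h1, fun x hx y hy hxy ↦ (h2 x hx y hy hxy).le⟩
  obtain ⟨η₁, h1, h1'⟩ := unif a₂ ha₂
  obtain ⟨η₂, h2, h2'⟩ := unif a₃ ha₃
  obtain ⟨η₃, h3, h3'⟩ := unif b₂ hb₂
  obtain ⟨η₄, h4, h4'⟩ := unif b₃ hb₃
  obtain ⟨M, hM⟩ := exists_nat_one_div_lt (show 0 < min (min η₁ η₂) (min η₃ η₄) by positivity)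
  simp only [lt_min_iff] at hM
  refine ⟨c, 2 * B, M + 1, hc0, by positivity, by omega, fun j₁ j₂ J hJ hmax ↦ ?_⟩
  have hj₁ : |j₁| ≤ J := hmax ▸ le_max_left _ _
  have hj₂ : |j₂| ≤ J := hmax ▸ le_max_right _ _
  have comb : ∀ s t C : ℝ, |s| ≤ C → |t| ≤ C → |j₁ * s + j₂ * t| ≤ 2 * C * J := by
    intro s t C hs ht
    refine (abs_add_le _ _).trans ?_
    rw [abs_mul, abs_mul]
    have := mul_le_mul hj₁ hs (abs_nonneg _) hJ.le
    have := mul_le_mul hj₂ ht (abs_nonneg _) hJ.le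
    linarith
  refine ⟨fun x hx ↦ comb _ _ _ (hBa₂ x hx) (hBb₂ x hx), fun u v hu huv hv huvM ↦ ?_⟩
  have hsub : Set.Icc u v ⊆ Set.Icc (0 : ℝ) 1 := Set.Icc_subset_Icc hu hv
  have huI : u ∈ Set.Icc (0 : ℝ) 1 := ⟨hu, huv.trans hv⟩
  have close : ∀ x ∈ Set.Icc u v, |x - u| ≤ 1 / ((M : ℝ) + 1) := by
    intro x hx
    push_cast at huvM
    rw [abs_of_nonneg (by linarith [hx.1])]
    linarith [hx.2]
  have stay : ∀ a b : ℝ → ℝ, (∀ x ∈ Set.Icc u v, |a x - a u| ≤ c / 2) →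
      (∀ x ∈ Set.Icc u v, |b x - b u| ≤ c / 2) → 4 * c * J ≤ |j₁ * a u + j₂ * b u| →
      ∃ τ : ℝ, (τ = 1 ∨ τ = -1) ∧ ∀ x ∈ Set.Icc u v, c * J ≤ τ * (j₁ * a x + j₂ * b x) := by
    intro a b ha hb h
    have hd : ∀ x ∈ Set.Icc u v,
        |(j₁ * a x + j₂ * b x) - (j₁ * a u + j₂ * b u)| ≤ c * J := by
      intro x hx
      have := comb _ _ _ (ha x hx) (hb x hx)
      rw [show (j₁ * a x + j₂ * b x) - (j₁ * a u + j₂ * b u) =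
        j₁ * (a x - a u) + j₂ * (b x - b u) by ring]
      linarith
    have hcJ : 0 < c * J := by positivity
    rcases le_total 0 (j₁ * a u + j₂ * b u) with h0 | h0
    · rw [abs_of_nonneg h0] at h
      exact ⟨1, Or.inl rfl, fun x hx ↦ by linarith [(abs_le.mp (hd x hx)).1]⟩
    · rw [abs_of_nonpos h0] at h
      exact ⟨-1, Or.inr rfl, fun x hx ↦ by linarith [(abs_le.mp (hd x hx)).2]⟩
  -- Cramer's rule bounds `j₁` and `j₂` by the two combinations at `u`
  have big : 4 * c * J ≤ |j₁ * a₂ u + j₂ * b₂ u| ∨ 4 * c * J ≤ |j₁ * a₃ u + j₂ * b₃ u| := by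
    by_contra! hcon
    obtain ⟨hp, hr⟩ := hcon
    set p := j₁ * a₂ u + j₂ * b₂ u with hp'
    set r := j₁ * a₃ u + j₂ * b₃ u with hr'
    have cr : ∀ s t : ℝ, |s| ≤ B → |t| ≤ B → |p * s - r * t| < D * J := by
      intro s t hs ht
      have e1 : D * J = 4 * c * J * B + 4 * c * J * B := by rw [hc]; field_simp; ring
      refine (abs_sub _ _).trans_lt ?_
      rw [abs_mul, abs_mul, e1]
      have := mul_le_mul_of_nonneg_left hs (abs_nonneg p)
      have := mul_le_mul_of_nonneg_left ht (abs_nonneg r)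
      have := mul_lt_mul_of_pos_right hp hB0
      have := mul_lt_mul_of_pos_right hr hB0
      linarith
    have c1 := cr _ _ (hBb₃ u huI) (hBb₂ u huI)
    have c2 := cr _ _ (hBa₃ u huI) (hBa₂ u huI)
    have i1 : p * b₃ u - r * b₂ u = j₁ * (a₂ u * b₃ u - b₂ u * a₃ u) := by
      rw [hp', hr']; ring
    have i2 : p * a₃ u - r * a₂ u = -j₂ * (a₂ u * b₃ u - b₂ u * a₃ u) := by
      rw [hp', hr']; ring
    rw [i1, abs_mul] at c1
    rw [i2, abs_mul, abs_neg] at c2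
    have hDu := hD u huI
    rcases max_choice |j₁| |j₂| with h | h <;> rw [hmax] at h
    · rw [← h] at c1; nlinarith
    · rw [← h] at c2; nlinarith
  rcases big with h | h
  · obtain ⟨τ, hτ, hx⟩ := stay a₂ b₂
      (fun x hx ↦ h1' x (hsub hx) u huI ((close x hx).trans_lt hM.1.1))
      (fun x hx ↦ h3' x (hsub hx) u huI ((close x hx).trans_lt hM.2.1)) h
    exact ⟨τ, hτ, Or.inl hx⟩
  · obtain ⟨τ, hτ, hx⟩ := stay a₃ b₃
      (fun x hx ↦ h2' x (hsub hx) u huI ((close x hx).trans_lt hM.1.2))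
      (fun x hx ↦ h4' x (hsub hx) u huI ((close x hx).trans_lt hM.2.2)) h
    exact ⟨τ, hτ, Or.inr hx⟩

/-! ### The Weyl sums of the curve -/

lemma hasDerivWithinAt_iteratedDerivWithin {f : ℝ → ℝ} (hf : ContDiffOn ℝ 3 f (Set.Icc 0 1))
    {k : ℕ} (hk : k < 3) {x : ℝ} (hx : x ∈ Set.Icc (0 : ℝ) 1) :
    HasDerivWithinAt (iteratedDerivWithin k f (Set.Icc 0 1))
      (iteratedDerivWithin (k + 1) f (Set.Icc 0 1) x) (Set.Icc 0 1) x := by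
  have := hf.differentiableOn_iteratedDerivWithin (m := k) (by exact_mod_cast hk)
    (uniqueDiffOn_Icc zero_lt_one) x hx
  rw [iteratedDerivWithin_succ]
  exact this.hasDerivWithinAt

/-- The exponential sum along the curve in the direction `(j₁, j₂)`, bounded with a free parameter
`r`: up to a constant, `r² q` terms near each point where the second derivative of `j₁ f₁ + j₂ f₂`
may be small are estimated trivially. -/
theorem exists_norm_expSum_le {f₁ f₂ : ℝ → ℝ} (hf₁ : ContDiffOn ℝ 3 f₁ (Set.Icc 0 1))
    (hf₂ : ContDiffOn ℝ 3 f₂ (Set.Icc 0 1))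
    (hdet : ∀ x ∈ Set.Icc (0 : ℝ) 1,
      iteratedDerivWithin 2 f₁ (Set.Icc 0 1) x * iteratedDerivWithin 3 f₂ (Set.Icc 0 1) x -
      iteratedDerivWithin 2 f₂ (Set.Icc 0 1) x * iteratedDerivWithin 3 f₁ (Set.Icc 0 1) x ≠ 0) :
    ∃ K : ℝ, 0 < K ∧ ∀ q j₁ j₂ J r : ℝ, 2 ≤ q → 1 ≤ J → max |j₁| |j₂| = J → 0 < r → r ≤ 1 →
      ‖∑ n ∈ range (⌊q⌋₊ + 1), e (q * (j₁ * f₁ (n / q) + j₂ * f₂ (n / q)))‖ ≤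
        K * (√(q * J) + √(q / J) / r + q * r ^ 2) := by
  set I := Set.Icc (0 : ℝ) 1 with hI
  have hcont : ∀ f : ℝ → ℝ, ContDiffOn ℝ 3 f I → ∀ k : ℕ, k ≤ 3 →
      ContinuousOn (iteratedDerivWithin k f I) I := fun f hf k hk ↦
    hf.continuousOn_iteratedDerivWithin (by exact_mod_cast hk) (uniqueDiffOn_Icc zero_lt_one)
  obtain ⟨c, B, M, hc, hB, hM, H⟩ := exists_uniform_lower_bound (hcont f₁ hf₁ 2 (by norm_num))
    (hcont f₁ hf₁ 3 le_rfl) (hcont f₂ hf₂ 2 (by norm_num)) (hcont f₂ hf₂ 3 le_rfl) hdet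
  have hM' : (0 : ℝ) < M := by exact_mod_cast hM
  set Kp := 2 * (2 + 1 + 80 * B * √(2 / c) + 40 / √c) with hKp
  have hKp0 : 0 < Kp := by positivity
  refine ⟨2 * √(2 * c) + (M + 1) * Kp, by positivity, fun q j₁ j₂ J r hq hJ hmax hr hr1 ↦ ?_⟩
  have hq0 : 0 < q := by linarith
  have hJ0 : 0 < J := by linarith
  set T := √(q * J) + √(q / J) / r + q * r ^ 2 with hT
  have hN : ((⌊q⌋₊ + 1 : ℕ) : ℝ) ≤ 2 * q := by
    push_cast; linarith [Nat.floor_le hq0.le]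
  by_cases hbig : q < 2 * c * J
  · -- large frequencies: the trivial bound
    have h1 := norm_sum_e_le_card (fun n ↦ q * (j₁ * f₁ (n / q) + j₂ * f₂ (n / q)))
      (range (⌊q⌋₊ + 1))
    rw [card_range] at h1
    have h2 : q ≤ √(2 * c) * √(q * J) := by
      rw [← sqrt_mul (by positivity)]
      apply le_sqrt_of_sq_le
      nlinarith
    have h3 : √(q * J) ≤ T := by
      have : 0 ≤ √(q / J) / r + q * r ^ 2 := by positivity
      linarith
    have h4 : 0 ≤ (M + 1) * Kp * T := by positivity
    have h5 : √(2 * c) * √(q * J) ≤ √(2 * c) * T := mul_le_mul_of_nonneg_left h3 (sqrt_nonneg _)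
    linarith
  push Not at hbig
  obtain ⟨hbd, hloc⟩ := H j₁ j₂ J hJ0 hmax
  set F : ℕ → ℝ → ℝ := fun k x ↦
    j₁ * iteratedDerivWithin k f₁ I x + j₂ * iteratedDerivWithin k f₂ I x with hF
  have hder : ∀ k < 3, ∀ x ∈ I, HasDerivWithinAt (F k) (F (k + 1) x) I x := fun k hk x hx ↦
    ((hasDerivWithinAt_iteratedDerivWithin hf₁ hk hx).const_mul j₁).add
      ((hasDerivWithinAt_iteratedDerivWithin hf₂ hk hx).const_mul j₂)
  have hF0 : ∀ x, j₁ * f₁ x + j₂ * f₂ x = F 0 x := fun x ↦ by simp [hF]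
  simp_rw [hF0]
  set s : ℕ → Finset ℕ := fun i ↦
    (range (⌊q⌋₊ + 1)).filter fun n : ℕ ↦ ⌊(M : ℝ) * (n / q)⌋₊ = i with hs
  have hnq : ∀ n ∈ range (⌊q⌋₊ + 1), (n : ℝ) / q ≤ 1 := fun n hn ↦ by
    rw [div_le_one hq0]
    exact (Nat.le_floor_iff hq0.le).mp (Nat.lt_succ_iff.mp (mem_range.mp hn))
  have hmaps : ∀ n ∈ range (⌊q⌋₊ + 1), ⌊(M : ℝ) * (n / q)⌋₊ ∈ range (M + 1) := fun n hn ↦ by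
    rw [mem_range, Nat.lt_succ_iff]
    refine Nat.floor_le_of_le ?_
    have := mul_le_mul_of_nonneg_left (hnq n hn) hM'.le
    linarith
  have piece : ∀ i ∈ range (M + 1), ‖∑ n ∈ s i, e (q * F 0 (n / q))‖ ≤ Kp * T := by
    intro i hi
    have hi : (i : ℝ) ≤ M := by exact_mod_cast Nat.lt_succ_iff.mp (mem_range.mp hi)
    set u : ℝ := i / M with hu
    set v : ℝ := min 1 ((i + 1) / M) with hv
    have hu0 : 0 ≤ u := by positivity
    have hu1 : u ≤ 1 := by rw [hu, div_le_one hM']; exact hi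
    have huv : u ≤ v := le_min hu1 (div_le_div_of_nonneg_right (by linarith) hM'.le)
    have hv1 : v ≤ 1 := min_le_left _ _
    have hvu : v - u ≤ 1 / M := by
      have : v ≤ (i + 1) / M := min_le_right _ _
      rw [add_div] at this
      linarith
    obtain ⟨τ, hτ, hlow⟩ := hloc u v hu0 huv hv1 hvu
    obtain ⟨x₀, hx₀, σ₁, σ₂, hσ₁, hσ₂, hl₁, hl₂⟩ := exists_signed_lower_bound
      (F₂ := F 2) (F₃ := F 3) (mul_pos hc hJ0) hu0 huv hv1 hτ (hder 2 (by norm_num)) hlow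
    have hord : (s i : Set ℕ).OrdConnected := by
      refine ⟨fun n hn m hm k hk ↦ ?_⟩
      simp only [hs, coe_filter, Set.mem_ofPred_eq, mem_range] at hn hm ⊢
      have mono : ∀ a b : ℕ, a ≤ b → ⌊(M : ℝ) * (a / q)⌋₊ ≤ ⌊(M : ℝ) * (b / q)⌋₊ := by
        intro a b hab
        apply Nat.floor_le_floor
        apply mul_le_mul_of_nonneg_left _ hM'.le
        exact div_le_div_of_nonneg_right (by exact_mod_cast hab) hq0.le
      exact ⟨lt_of_le_of_lt hk.2 hm.1, le_antisymm ((mono _ _ hk.2).trans hm.2.le)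
        (hn.2.symm.le.trans (mono _ _ hk.1))⟩
    have hcard : ((s i).card : ℝ) ≤ 2 * q := by
      refine le_trans ?_ hN
      have := card_filter_le (range (⌊q⌋₊ + 1)) (fun n : ℕ ↦ ⌊(M : ℝ) * (n / q)⌋₊ = i)
      rw [card_range] at this
      exact_mod_cast this
    have hsuv : ∀ n ∈ s i, (n : ℝ) / q ∈ Set.Icc u v := by
      intro n hn
      obtain ⟨hn1, hn2⟩ := mem_filter.mp hn
      rw [Nat.floor_eq_iff (by positivity)] at hn2
      refine ⟨?_, le_min (hnq n hn1) ?_⟩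
      · rw [hu, div_le_iff₀ hM']; linarith [hn2.1]
      · rw [le_div_iff₀ hM']; linarith [hn2.2]
    have hr2 : r ^ 2 ≤ 1 := pow_le_one₀ hr.le hr1
    have hqr : 0 < q * r ^ 2 := by positivity
    have main := norm_sum_e_piece_le (F := F 0) (F₁ := F 1) (F₂ := F 2) (hder 0 (by norm_num))
      (hder 1 (by norm_num)) (q := q) (κ := c * J) (B := B * J) (R := 1 + q * r ^ 2) (X := 2 * q)
      hq0 (by positivity) (by positivity) (by linarith) (by nlinarith) (by nlinarith) hu0 hv1 hx₀
      hσ₁ hσ₂ (fun x hx ↦ hbd x ⟨hu0.trans hx.1, hx.2.trans hv1⟩) hl₁ hl₂ (s i) hord hcard hsuv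
    refine main.trans ?_
    have b1 : 1 ≤ √(q * J) := one_le_sqrt.mpr (by nlinarith)
    have b2 : B * J / q * √(2 * q / (c * J / q ^ 2)) = B * √(2 / c) * √(q * J) := by
      have e1 : 2 * q / (c * J / q ^ 2) = (2 / c) * (q * J) * (q / J) ^ 2 := by
        field_simp
      rw [e1, sqrt_mul (by positivity), sqrt_mul (by positivity), sqrt_sq (by positivity)]
      field_simp
    have b3 : 40 / √(c * J / q ^ 2 * (1 + q * r ^ 2)) ≤ 40 / √c * (√(q / J) / r) := by
      have e1 : √c * r / √(q / J) ≤ √(c * J / q ^ 2 * (1 + q * r ^ 2)) := by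
        apply le_sqrt_of_sq_le
        rw [div_pow, mul_pow, sq_sqrt hc.le, sq_sqrt (by positivity)]
        have : c * r ^ 2 / (q / J) = c * J / q ^ 2 * (q * r ^ 2) := by field_simp
        rw [this]
        exact mul_le_mul_of_nonneg_left (by linarith) (by positivity)
      have e2 : 40 / √c * (√(q / J) / r) = 40 / (√c * r / √(q / J)) := by field_simp
      rw [e2]
      exact div_le_div_of_nonneg_left (by norm_num) (by positivity) e1
    have t2 : 0 ≤ √(q / J) / r := by positivity
    have p1 : 0 ≤ 80 * B * √(2 / c) := by positivity
    have p2 : 0 ≤ 40 / √c := by positivity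
    have t1 : √(q * J) ≤ T := by linarith
    have t3 : √(q / J) / r ≤ T := by linarith
    have t4 : q * r ^ 2 ≤ T := by linarith
    have m1 := mul_le_mul_of_nonneg_left t1 p1
    have m2 := mul_le_mul_of_nonneg_left t3 p2
    rw [mul_assoc 80, b2]
    rw [hKp]
    linarith
  have htotal : ‖∑ n ∈ range (⌊q⌋₊ + 1), e (q * F 0 (n / q))‖ ≤ (M + 1) * Kp * T := by
    rw [← sum_fiberwise_of_maps_to hmaps]
    refine (norm_sum_le _ _).trans ((sum_le_sum piece).trans ?_)
    rw [sum_const, card_range, nsmul_eq_mul]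
    push_cast
    linarith
  refine htotal.trans ?_
  have : 0 ≤ 2 * √(2 * c) * T := by positivity
  linarith

lemma secondThirdDet_ne_zero_of_torsionWithin_ne_zero {f₁ f₂ : ℝ → ℝ}
    (hf₁ : ContDiffOn ℝ 3 f₁ (Set.Icc 0 1)) (hf₂ : ContDiffOn ℝ 3 f₂ (Set.Icc 0 1))
    {x : ℝ} (hx : x ∈ Set.Icc (0 : ℝ) 1)
    (h : torsionWithin (monge f₁ f₂) (Set.Icc 0 1) x ≠ 0) :
    iteratedDerivWithin 2 f₁ (Set.Icc 0 1) x * iteratedDerivWithin 3 f₂ (Set.Icc 0 1) x -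
      iteratedDerivWithin 2 f₂ (Set.Icc 0 1) x * iteratedDerivWithin 3 f₁ (Set.Icc 0 1) x ≠ 0 := by
  set I := Set.Icc (0 : ℝ) 1 with hI
  have hu : UniqueDiffOn ℝ I := uniqueDiffOn_Icc zero_lt_one
  have hid : ContDiffOn ℝ 3 (fun x : ℝ ↦ x) I := contDiffOn_id
  have comp : ∀ k ≤ 3, ∀ y ∈ I, iteratedDerivWithin k (monge f₁ f₂) I y =
      ![iteratedDerivWithin k (fun x ↦ x) I y, iteratedDerivWithin k f₁ I y,
        iteratedDerivWithin k f₂ I y] := by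
    intro k
    induction k with
    | zero => intro _ y _; simp [monge]
    | succ k ih =>
      intro hk y hy
      rw [iteratedDerivWithin_succ]
      refine HasDerivWithinAt.derivWithin ?_ (hu y hy)
      refine HasDerivWithinAt.congr (f := fun y ↦ ![iteratedDerivWithin k (fun x ↦ x) I y,
        iteratedDerivWithin k f₁ I y, iteratedDerivWithin k f₂ I y]) ?_
        (fun z hz ↦ ih (by omega) z hz) (ih (by omega) y hy)
      rw [hasDerivWithinAt_pi]
      intro i
      fin_cases i
      · exact hasDerivWithinAt_iteratedDerivWithin hid (by omega) hy
      · exact hasDerivWithinAt_iteratedDerivWithin hf₁ (by omega) hy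
      · exact hasDerivWithinAt_iteratedDerivWithin hf₂ (by omega) hy
  have d1 : ∀ y ∈ I, iteratedDerivWithin 1 (fun x : ℝ ↦ x) I y = 1 := fun y hy ↦ by
    rw [iteratedDerivWithin_one]; exact derivWithin_id' y I (hu y hy)
  have d2 : ∀ y ∈ I, iteratedDerivWithin 2 (fun x : ℝ ↦ x) I y = 0 := fun y hy ↦ by
    rw [iteratedDerivWithin_succ, derivWithin_congr (f := fun _ ↦ (1 : ℝ)) d1 (d1 y hy)]
    simp
  have d3 : ∀ y ∈ I, iteratedDerivWithin 3 (fun x : ℝ ↦ x) I y = 0 := fun y hy ↦ by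
    rw [iteratedDerivWithin_succ, derivWithin_congr (f := fun _ ↦ (0 : ℝ)) d2 (d2 y hy)]
    simp
  intro h0
  apply h
  unfold torsionWithin
  rw [comp 1 (by norm_num) x hx, comp 2 (by norm_num) x hx, comp 3 le_rfl x hx, d1 x hx, d2 x hx,
    d3 x hx, Matrix.det_fin_three]
  simp
  left
  linarith

/-! ### The tent function and its Fourier coefficients -/

/-- The tent `max 0 (δ - ‖y‖)`, a `1`-periodic function of `y`. -/
noncomputable def tent (δ y : ℝ) : ℝ := max 0 (δ - distInt y)

/-- The coefficient of `cos (2πny)`, `n ≥ 1`, in the Fourier series of `tent δ`. -/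
noncomputable def tentCoeff (δ : ℝ) (n : ℕ) : ℝ := (1 - cos (2 * π * n * δ)) / (π ^ 2 * n ^ 2)

lemma hasSum_cos_div_sq {x : ℝ} (hx : x ∈ Set.Icc (0 : ℝ) 1) :
    HasSum (fun n : ℕ ↦ 1 / (n : ℝ) ^ 2 * cos (2 * π * n * x)) (π ^ 2 * (x ^ 2 - x + 1 / 6)) := by
  have h := hasSum_one_div_nat_pow_mul_cos one_ne_zero hx
  have e1 : (Polynomial.map (algebraMap ℚ ℝ) (Polynomial.bernoulli (2 * 1))).eval x =
      x ^ 2 - x + 1 / 6 := by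
    rw [Polynomial.bernoulli_def]
    simp [Finset.sum_range_succ, Polynomial.map_add, bernoulli_two, bernoulli_one,
      Polynomial.eval_add, Polynomial.map_monomial]
    ring
  have e2 : (-1 : ℝ) ^ (1 + 1) * (2 * π) ^ (2 * 1) / 2 / ((2 * 1).factorial : ℝ) = π ^ 2 := by
    norm_num [Nat.factorial]
    ring
  rw [e1, e2] at h
  simpa only [mul_one] using h

/-- The tent is `-1 / 2` times a second difference, with step `δ`, of the periodic quadratic
Bernoulli function, which gives its Fourier series without computing an integral. -/
lemma hasSum_tent {δ : ℝ} (hδ : 0 < δ) (hδ1 : δ ≤ 1 / 2) (y : ℝ) :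
    HasSum (fun n : ℕ ↦ tentCoeff δ n * cos (2 * π * n * y)) (tent δ y - δ ^ 2) := by
  set s := distInt y with hs
  have hs0 : 0 ≤ s := abs_nonneg _
  have hs1 : s ≤ 1 / 2 := abs_sub_round y
  have hcos : ∀ n : ℕ, cos (2 * π * n * y) = cos (2 * π * n * s) := by
    intro n
    have e1 : cos (2 * π * n * s) = cos (2 * π * n * (y - round y)) := by
      rw [hs, distInt]
      rcases abs_choice (y - round y) with h | h <;> rw [h]
      rw [mul_neg, cos_neg]
    rw [e1, show 2 * π * n * (y - round y) = 2 * π * n * y - ((n * round y : ℤ) : ℝ) * (2 * π) by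
      push_cast; ring, cos_sub_int_mul_two_pi]
  have h1 := hasSum_cos_div_sq (x := s) ⟨hs0, by linarith⟩
  have h2 := hasSum_cos_div_sq (x := s + δ) ⟨by linarith, by linarith⟩
  have h3 := hasSum_cos_div_sq (x := |s - δ|) ⟨abs_nonneg _, by
    rw [abs_le]; constructor <;> linarith⟩
  have h4 := ((h1.sub ((h2.add h3).div_const 2)).div_const (π ^ 2))
  have ev : tent δ y - δ ^ 2 = (π ^ 2 * (s ^ 2 - s + 1 / 6) -
      (π ^ 2 * ((s + δ) ^ 2 - (s + δ) + 1 / 6) +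
        π ^ 2 * (|s - δ| ^ 2 - |s - δ| + 1 / 6)) / 2) / π ^ 2 := by
    have hpi : π ^ 2 ≠ 0 := by positivity
    rw [tent, ← hs]
    rcases le_total s δ with h | h
    · rw [max_eq_right (by linarith), abs_of_nonpos (by linarith)]; field_simp; ring
    · rw [max_eq_left (by linarith), abs_of_nonneg (by linarith)]; field_simp; ring
  rw [ev]
  have ef : (fun n : ℕ ↦ tentCoeff δ n * cos (2 * π * n * y)) = fun n : ℕ ↦
      (1 / (n : ℝ) ^ 2 * cos (2 * π * n * s) - (1 / (n : ℝ) ^ 2 * cos (2 * π * n * (s + δ)) +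
        1 / (n : ℝ) ^ 2 * cos (2 * π * n * |s - δ|)) / 2) / π ^ 2 := by
    funext n
    rw [hcos n, tentCoeff]
    have e3 : cos (2 * π * n * |s - δ|) = cos (2 * π * n * s - 2 * π * n * δ) := by
      rcases abs_choice (s - δ) with h | h <;> rw [h]
      · rw [mul_sub]
      · rw [mul_neg, cos_neg, mul_sub]
    rw [e3, show 2 * π * n * (s + δ) = 2 * π * n * s + 2 * π * n * δ by ring, cos_add, cos_sub]
    rcases Nat.eq_zero_or_pos n with rfl | hn
    · simp
    · have : (n : ℝ) ≠ 0 := by positivity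
      field_simp
      ring
  rw [ef]
  exact h4

lemma tentCoeff_nonneg (δ : ℝ) (n : ℕ) : 0 ≤ tentCoeff δ n :=
  div_nonneg (by linarith [cos_le_one (2 * π * n * δ)]) (by positivity)

lemma tentCoeff_le_sq (δ : ℝ) {n : ℕ} (hn : 0 < n) : tentCoeff δ n ≤ 2 * δ ^ 2 := by
  rw [tentCoeff, div_le_iff₀ (by positivity)]
  have := one_sub_sq_div_two_le_cos (x := 2 * π * n * δ)
  nlinarith

lemma tentCoeff_le_inv_sq (δ : ℝ) {n : ℕ} (hn : 0 < n) : tentCoeff δ n ≤ 1 / (n : ℝ) ^ 2 := by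
  have hn' : (0 : ℝ) < n := by exact_mod_cast hn
  rw [tentCoeff, div_le_div_iff₀ (by positivity) (by positivity)]
  have h1 := neg_one_le_cos (2 * π * n * δ)
  have h2 : 2 ≤ π ^ 2 := by nlinarith [pi_gt_three]
  have h3 : 0 < (n : ℝ) ^ 2 := by positivity
  nlinarith

lemma sum_inv_mul_sqrt_le (a N : ℕ) (ha : 0 < a) :
    ∑ k ∈ range N, 1 / (((a + k : ℕ) : ℝ) * √(a + k : ℕ)) ≤ 4 * (1 / √a - 1 / √(a + N : ℕ)) := by
  induction N with
  | zero => simp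
  | succ N ih =>
    rw [sum_range_succ]
    set x : ℝ := ((a + N : ℕ) : ℝ) with hx
    have hx1 : 1 ≤ x := by rw [hx]; exact_mod_cast (by omega : 1 ≤ a + N)
    have hx' : ((a + (N + 1) : ℕ) : ℝ) = x + 1 := by rw [hx]; push_cast; ring
    rw [hx']
    set s := √x with hs
    set t := √(x + 1) with ht
    have hs2 : s * s = x := mul_self_sqrt (by linarith)
    have ht2 : t * t = x + 1 := mul_self_sqrt (by linarith)
    have hs0 : 0 < s := sqrt_pos.mpr (by linarith)
    have hst : s ≤ t := sqrt_le_sqrt (by linarith)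
    have ht3 : t ≤ 3 / 2 * s := by nlinarith
    have key : 1 / (x * s) ≤ 4 * (1 / s - 1 / t) := by
      have ht0 : 0 < t := by linarith
      have e1 : 4 * (1 / s - 1 / t) = 4 / (s * t * (s + t)) := by
        have : (t - s) * (s + t) = 1 := by nlinarith
        field_simp
        linarith
      rw [e1, div_le_div_iff₀ (by positivity) (by positivity), ← hs2]
      have : t * (s + t) ≤ 4 * (s * s) := by nlinarith
      nlinarith
    linarith

lemma sum_range_le_add_tail {t : ℕ → ℝ} (ht : ∀ n, 0 ≤ t n) (J N : ℕ) :
    ∑ n ∈ range N, t n ≤ ∑ n ∈ range J, t n + ∑ k ∈ range N, t (J + k) := by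
  rw [← sum_range_add]
  exact sum_le_sum_of_subset_of_nonneg (range_mono (by omega)) (fun _ _ _ ↦ ht _)

lemma sum_inv_sqrt_le (J : ℕ) : ∑ n ∈ range J, 1 / √((n + 1 : ℕ) : ℝ) ≤ 2 * √J := by
  induction J with
  | zero => simp
  | succ J ih =>
    rw [sum_range_succ]
    set s := √(J : ℝ) with hs
    set t := √((J + 1 : ℕ) : ℝ) with ht
    have hs2 : s * s = J := mul_self_sqrt (by positivity)
    have ht2 : t * t = J + 1 := by rw [ht, mul_self_sqrt (by positivity)]; push_cast; ring
    have hs0 : 0 ≤ s := sqrt_nonneg _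
    have ht0 : 0 < t := sqrt_pos.mpr (by positivity)
    have hst : s ≤ t := sqrt_le_sqrt (by push_cast; linarith)
    have : 1 / t ≤ 2 * (t - s) := by
      rw [div_le_iff₀ ht0]; nlinarith
    linarith

lemma tail_sum_le {δ : ℝ} (hδ : 0 < δ) (N : ℕ) :
    ∑ k ∈ range N, 1 / (((⌊1 / δ⌋₊ + 1 + k : ℕ) : ℝ) * √(⌊1 / δ⌋₊ + 1 + k : ℕ)) ≤ 4 * √δ := by
  refine (sum_inv_mul_sqrt_le _ N (by omega)).trans ?_
  have h1 : 1 / δ < ((⌊1 / δ⌋₊ + 1 : ℕ) : ℝ) := by push_cast; exact Nat.lt_floor_add_one _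
  have h2 : 1 / √((⌊1 / δ⌋₊ + 1 : ℕ) : ℝ) ≤ √δ := by
    rw [div_le_iff₀ (by positivity), ← sqrt_mul hδ.le]
    apply one_le_sqrt.mpr
    rw [div_lt_iff₀ hδ] at h1
    linarith
  have h3 : 0 ≤ 1 / √((⌊1 / δ⌋₊ + 1 + N : ℕ) : ℝ) := by positivity
  linarith

/-- The common scheme of the next three bounds: for `n ≤ 1 / δ` the coefficient is at most `2 δ²`,
and for `n > 1 / δ` at most `1 / n²`. -/
lemma sum_tentCoeff_mul_le {δ : ℝ} (hδ : 0 < δ) {p : ℕ → ℝ} (hp : ∀ n, 0 ≤ p n) {b : ℝ}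
    (hb : 0 ≤ b) (htail : ∀ n : ℕ, 0 < n → 1 ≤ n * δ → p n / (n : ℝ) ^ 2 ≤ b / (n * √n)) (N : ℕ) :
    ∑ n ∈ range N, tentCoeff δ (n + 1) * p (n + 1) ≤
      2 * δ ^ 2 * ∑ n ∈ range ⌊1 / δ⌋₊, p (n + 1) + b * (4 * √δ) := by
  refine (sum_range_le_add_tail (fun n ↦ mul_nonneg (tentCoeff_nonneg _ _) (hp _))
    ⌊1 / δ⌋₊ N).trans ?_
  refine add_le_add ?_ ?_
  · rw [mul_sum]
    exact sum_le_sum fun n _ ↦ mul_le_mul_of_nonneg_right (tentCoeff_le_sq δ n.succ_pos) (hp _)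
  · refine le_trans ?_ (mul_le_mul_of_nonneg_left (tail_sum_le hδ N) hb)
    rw [mul_sum]
    refine sum_le_sum fun k _ ↦ ?_
    rw [show ⌊1 / δ⌋₊ + k + 1 = ⌊1 / δ⌋₊ + 1 + k by omega]
    set m := ⌊1 / δ⌋₊ + 1 + k with hm
    have hm0 : 0 < m := by omega
    have h1 : 1 ≤ m * δ := by
      have : 1 / δ ≤ m := by
        rw [hm]; push_cast
        linarith [Nat.lt_floor_add_one (1 / δ), (Nat.cast_nonneg k : (0 : ℝ) ≤ k)]
      rwa [div_le_iff₀ hδ] at this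
    refine (mul_le_mul_of_nonneg_right (tentCoeff_le_inv_sq δ hm0) (hp _)).trans ?_
    have := htail m hm0 h1
    rw [one_div_mul_eq_div, mul_one_div]
    exact this

lemma floor_mul_le {δ : ℝ} (hδ : 0 < δ) : (⌊1 / δ⌋₊ : ℝ) * δ ≤ 1 := by
  have := Nat.floor_le (show 0 ≤ 1 / δ by positivity)
  rwa [le_div_iff₀ hδ] at this

lemma sqrt_floor_mul_le {δ : ℝ} (hδ : 0 < δ) : √(⌊1 / δ⌋₊ : ℝ) * √δ ≤ 1 := by
  rw [← sqrt_mul (by positivity)]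
  exact sqrt_le_one.mpr (floor_mul_le hδ)

lemma sum_tentCoeff_le {δ : ℝ} (hδ : 0 < δ) (N : ℕ) :
    ∑ n ∈ range N, tentCoeff δ (n + 1) ≤ 6 * δ := by
  have h := sum_tentCoeff_mul_le hδ (p := fun _ ↦ 1) (fun _ ↦ zero_le_one) (b := √δ)
    (sqrt_nonneg _) (fun n hn h1 ↦ by
      have hn' : (0 : ℝ) < n := by exact_mod_cast hn
      have hs : 0 < √(n : ℝ) := sqrt_pos.mpr hn'
      rw [div_le_div_iff₀ (by positivity) (by positivity)]
      have h2 : 1 ≤ √(n : ℝ) * √δ := by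
        rw [← sqrt_mul hn'.le]; exact one_le_sqrt.mpr h1
      have h3 : √(n : ℝ) * √n = n := mul_self_sqrt hn'.le
      have h4 : (n : ℝ) * √n ≤ n * √n * (√n * √δ) := le_mul_of_one_le_right (by positivity) h2
      calc 1 * (n * √n) ≤ n * √n * (√n * √δ) := by linarith
        _ = √δ * (n * (√n * √n)) := by ring
        _ = √δ * n ^ 2 := by rw [h3]; ring) N
  simp only [mul_one, sum_const, card_range, nsmul_eq_mul] at h
  have h3 := floor_mul_le hδ
  have h4 : √δ * √δ = δ := mul_self_sqrt hδ.le
  nlinarith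

lemma sum_tentCoeff_mul_sqrt_le {δ : ℝ} (hδ : 0 < δ) (N : ℕ) :
    ∑ n ∈ range N, tentCoeff δ (n + 1) * √((n + 1 : ℕ) : ℝ) ≤ 6 * √δ := by
  have h := sum_tentCoeff_mul_le hδ (p := fun n ↦ √(n : ℝ)) (fun _ ↦ sqrt_nonneg _) (b := 1)
    zero_le_one (fun n hn _ ↦ by
      have hn' : (0 : ℝ) < n := by exact_mod_cast hn
      have hs : 0 < √(n : ℝ) := sqrt_pos.mpr hn'
      rw [div_le_div_iff₀ (by positivity) (by positivity)]
      have h3 : √(n : ℝ) * √n = n := mul_self_sqrt hn'.le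
      nlinarith) N
  refine h.trans ?_
  set J := ⌊1 / δ⌋₊ with hJ
  have h1 : ∑ n ∈ range J, √((n + 1 : ℕ) : ℝ) ≤ J * √J := by
    refine (sum_le_sum (g := fun _ ↦ √(J : ℝ)) fun n hn ↦ ?_).trans (by simp)
    exact sqrt_le_sqrt (by exact_mod_cast mem_range.mp hn)
  have h3 := floor_mul_le hδ
  have h5 := sqrt_floor_mul_le hδ
  rw [← hJ] at h3 h5
  have h4 : √δ * √δ = δ := mul_self_sqrt hδ.le
  have h6 : (J * δ) * (√J * √δ) ≤ 1 * 1 := mul_le_mul h3 h5 (by positivity) zero_le_one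
  have h7 : 2 * δ ^ 2 * (J * √J) = 2 * √δ * ((J * δ) * (√J * √δ)) := by
    nth_rewrite 1 [sq, ← h4]; ring
  have h8 := mul_le_mul_of_nonneg_left h1 (show 0 ≤ 2 * δ ^ 2 by positivity)
  rw [h7] at h8
  have h9 := mul_le_mul_of_nonneg_left h6 (show 0 ≤ 2 * √δ by positivity)
  linarith

lemma sum_tentCoeff_div_sqrt_le {δ : ℝ} (hδ : 0 < δ) (N : ℕ) :
    ∑ n ∈ range N, tentCoeff δ (n + 1) * (1 / √((n + 1 : ℕ) : ℝ)) ≤ 8 * (δ * √δ) := by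
  have h := sum_tentCoeff_mul_le hδ (p := fun n ↦ 1 / √(n : ℝ)) (fun _ ↦ by positivity) (b := δ)
    hδ.le (fun n hn h1 ↦ by
      have hn' : (0 : ℝ) < n := by exact_mod_cast hn
      have hs : 0 < √(n : ℝ) := sqrt_pos.mpr hn'
      rw [div_div, div_le_div_iff₀ (by positivity) (by positivity)]
      have h2 : (n : ℝ) * √n ≤ n * √n * (n * δ) := le_mul_of_one_le_right (by positivity) h1
      linarith) N
  refine h.trans ?_
  have h1 := sum_inv_sqrt_le ⌊1 / δ⌋₊
  set J := ⌊1 / δ⌋₊ with hJ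
  have h5 := sqrt_floor_mul_le hδ
  rw [← hJ] at h5
  have h4 : √δ * √δ = δ := mul_self_sqrt hδ.le
  have h7 : 2 * δ ^ 2 * (2 * √J) = 4 * (δ * √δ) * (√J * √δ) := by
    linear_combination (-4 * δ * √(J : ℝ)) * h4
  have h8 := mul_le_mul_of_nonneg_left h1 (show 0 ≤ 2 * δ ^ 2 by positivity)
  rw [h7] at h8
  have h9 := mul_le_mul_of_nonneg_left h5 (show 0 ≤ 4 * (δ * √δ) by positivity)
  linarith

/-! ### Weighted counting by Weyl sums -/

lemma abs_sum_cos_le_norm_sum_e (g : ℕ → ℝ) (s : Finset ℕ) :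
    |∑ a ∈ s, cos (2 * π * g a)| ≤ ‖∑ a ∈ s, e (g a)‖ := by
  have : ∑ a ∈ s, cos (2 * π * g a) = (∑ a ∈ s, e (g a)).re := by
    rw [Complex.re_sum]; simp_rw [e_re]
  rw [this]
  exact Complex.abs_re_le_norm _

/-- Partial sums of the Fourier series of `tent δ`. -/
noncomputable def tentPartial (δ : ℝ) (N : ℕ) (y : ℝ) : ℝ :=
  δ ^ 2 + ∑ n ∈ range N, tentCoeff δ (n + 1) * cos (2 * π * (n + 1 : ℕ) * y)

lemma tendsto_tentPartial {δ : ℝ} (hδ : 0 < δ) (hδ1 : δ ≤ 1 / 2) (y : ℝ) :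
    Filter.Tendsto (fun N ↦ tentPartial δ N y) Filter.atTop (nhds (tent δ y)) := by
  have h := (hasSum_tent hδ hδ1 y)
  rw [← hasSum_nat_add_iff' 1] at h
  have := h.tendsto_sum_nat.const_add (δ ^ 2)
  simpa [tentPartial, tentCoeff] using this

/-- The count of pairs `(Y a, Z a)` near `ℤ²`, weighted by tents, against its expected value
`δ⁴ #s`. The hypothesis `hE` bounds the Weyl sum with frequency
`(j₁, j₂)`; it is used for `(m, ±n)` with integers `m, n`, since
`cos x cos y = (cos (x + y) + cos (x - y)) / 2`. -/
lemma abs_sum_tent_mul_tent_sub_le {δ : ℝ} (hδ : 0 < δ) (hδ1 : δ ≤ 1 / 2) (s : Finset ℕ)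
    (Y Z : ℕ → ℝ) {A B C : ℝ} (hA : 0 ≤ A) (hB : 0 ≤ B) (hC : 0 ≤ C)
    (hE : ∀ j₁ j₂ J : ℝ, 1 ≤ J → max |j₁| |j₂| = J →
      ‖∑ a ∈ s, e (j₁ * Y a + j₂ * Z a)‖ ≤ A * √J + B * (1 / √J) + C) :
    |∑ a ∈ s, tent δ (Y a) * tent δ (Z a) - δ ^ 4 * s.card| ≤
      84 * (A * (δ * √δ) + B * (δ ^ 2 * √δ) + C * δ ^ 2) := by
  set c : ℕ → ℝ := fun n ↦ tentCoeff δ (n + 1) with hc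
  have hc0 : ∀ n, 0 ≤ c n := fun n ↦ tentCoeff_nonneg _ _
  set r : ℕ → ℝ := fun n ↦ √((n + 1 : ℕ) : ℝ) with hr
  have hr0 : ∀ n, 0 < r n := fun n ↦ sqrt_pos.mpr (by positivity)
  have one_le : ∀ n : ℕ, (1 : ℝ) ≤ ((n + 1 : ℕ) : ℝ) := fun n ↦ by
    push_cast; linarith [(Nat.cast_nonneg n : (0 : ℝ) ≤ n)]
  have hcos : ∀ j₁ j₂ J : ℝ, 1 ≤ J → max |j₁| |j₂| = J →
      |∑ a ∈ s, cos (2 * π * (j₁ * Y a + j₂ * Z a))| ≤ A * √J + B * (1 / √J) + C :=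
    fun j₁ j₂ J hJ hm ↦ (abs_sum_cos_le_norm_sum_e _ s).trans (hE j₁ j₂ J hJ hm)
  have hY : ∀ m : ℕ, |∑ a ∈ s, cos (2 * π * (m + 1 : ℕ) * Y a)| ≤
      A * r m + B * (1 / r m) + C := fun m ↦ by
    have := hcos ((m + 1 : ℕ) : ℝ) 0 ((m + 1 : ℕ) : ℝ) (one_le m) (by simp; positivity)
    simpa only [zero_mul, add_zero, mul_assoc] using this
  have hZ : ∀ m : ℕ, |∑ a ∈ s, cos (2 * π * (m + 1 : ℕ) * Z a)| ≤
      A * r m + B * (1 / r m) + C := fun m ↦ by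
    have := hcos 0 ((m + 1 : ℕ) : ℝ) ((m + 1 : ℕ) : ℝ) (one_le m) (by simp; positivity)
    simpa only [zero_mul, zero_add, mul_assoc] using this
  have hYZ : ∀ m n : ℕ,
      |∑ a ∈ s, cos (2 * π * (m + 1 : ℕ) * Y a) * cos (2 * π * (n + 1 : ℕ) * Z a)| ≤
      A * (r m + r n) + B * (1 / r m) + C := by
    intro m n
    set J : ℝ := max ((m + 1 : ℕ) : ℝ) ((n + 1 : ℕ) : ℝ) with hJ
    have hJ1 : 1 ≤ J := (one_le m).trans (le_max_left _ _)
    have hp := hcos ((m + 1 : ℕ) : ℝ) ((n + 1 : ℕ) : ℝ) J hJ1 (by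
      rw [abs_of_nonneg (by positivity), abs_of_nonneg (by positivity)])
    have hm := hcos ((m + 1 : ℕ) : ℝ) (-((n + 1 : ℕ) : ℝ)) J hJ1 (by
      rw [abs_neg, abs_of_nonneg (by positivity), abs_of_nonneg (by positivity)])
    have e1 : ∑ a ∈ s, cos (2 * π * (m + 1 : ℕ) * Y a) * cos (2 * π * (n + 1 : ℕ) * Z a) =
        (∑ a ∈ s, cos (2 * π * (((m + 1 : ℕ) : ℝ) * Y a + ((n + 1 : ℕ) : ℝ) * Z a)) +
        ∑ a ∈ s, cos (2 * π * (((m + 1 : ℕ) : ℝ) * Y a + -((n + 1 : ℕ) : ℝ) * Z a))) / 2 := by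
      rw [← sum_add_distrib, sum_div]
      refine sum_congr rfl fun a _ ↦ ?_
      rw [show 2 * π * (((m + 1 : ℕ) : ℝ) * Y a + ((n + 1 : ℕ) : ℝ) * Z a) =
        2 * π * (m + 1 : ℕ) * Y a + 2 * π * (n + 1 : ℕ) * Z a by ring,
        show 2 * π * (((m + 1 : ℕ) : ℝ) * Y a + -((n + 1 : ℕ) : ℝ) * Z a) =
        2 * π * (m + 1 : ℕ) * Y a - 2 * π * (n + 1 : ℕ) * Z a by ring, cos_add, cos_sub]
      ring
    have b1 : √J ≤ r m + r n := by
      rcases max_choice ((m + 1 : ℕ) : ℝ) ((n + 1 : ℕ) : ℝ) with h | h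
      · rw [hJ, h]; linarith [hr0 n]
      · rw [hJ, h]; linarith [hr0 m]
    have b2 : 1 / √J ≤ 1 / r m :=
      one_div_le_one_div_of_le (hr0 m) (sqrt_le_sqrt (le_max_left _ _))
    have b3 := mul_le_mul_of_nonneg_left b1 hA
    have b4 := mul_le_mul_of_nonneg_left b2 hB
    rw [e1, abs_div, abs_two]
    have := abs_add_le
      (∑ a ∈ s, cos (2 * π * (((m + 1 : ℕ) : ℝ) * Y a + ((n + 1 : ℕ) : ℝ) * Z a)))
      (∑ a ∈ s, cos (2 * π * (((m + 1 : ℕ) : ℝ) * Y a + -((n + 1 : ℕ) : ℝ) * Z a)))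
    linarith
  have bound : ∀ N, |∑ a ∈ s, tentPartial δ N (Y a) * tentPartial δ N (Z a) - δ ^ 4 * s.card| ≤
      84 * (A * (δ * √δ) + B * (δ ^ 2 * √δ) + C * δ ^ 2) := by
    intro N
    set W₀ := ∑ n ∈ range N, c n with hW₀
    set W₁ := ∑ n ∈ range N, c n * r n with hW₁
    set W₂ := ∑ n ∈ range N, c n * (1 / r n) with hW₂
    have w0 : W₀ ≤ 6 * δ := sum_tentCoeff_le hδ N
    have w1 : W₁ ≤ 6 * √δ := sum_tentCoeff_mul_sqrt_le hδ N
    have w2 : W₂ ≤ 8 * (δ * √δ) := sum_tentCoeff_div_sqrt_le hδ N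
    have w0' : 0 ≤ W₀ := sum_nonneg fun n _ ↦ hc0 n
    have w1' : 0 ≤ W₁ := sum_nonneg fun n _ ↦ mul_nonneg (hc0 n) (hr0 n).le
    have w2' : 0 ≤ W₂ := sum_nonneg fun n _ ↦ mul_nonneg (hc0 n) (by have := hr0 n; positivity)
    have expand : ∑ a ∈ s, tentPartial δ N (Y a) * tentPartial δ N (Z a) - δ ^ 4 * s.card =
        δ ^ 2 * ∑ m ∈ range N, c m * ∑ a ∈ s, cos (2 * π * (m + 1 : ℕ) * Y a) +
        δ ^ 2 * ∑ m ∈ range N, c m * ∑ a ∈ s, cos (2 * π * (m + 1 : ℕ) * Z a) +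
        ∑ m ∈ range N, ∑ n ∈ range N, c m * c n *
          ∑ a ∈ s, cos (2 * π * (m + 1 : ℕ) * Y a) * cos (2 * π * (n + 1 : ℕ) * Z a) := by
      have e1 : ∀ a, tentPartial δ N (Y a) * tentPartial δ N (Z a) = δ ^ 4 +
          δ ^ 2 * ∑ m ∈ range N, c m * cos (2 * π * (m + 1 : ℕ) * Y a) +
          δ ^ 2 * ∑ m ∈ range N, c m * cos (2 * π * (m + 1 : ℕ) * Z a) +
          ∑ m ∈ range N, ∑ n ∈ range N, c m * c n *
            (cos (2 * π * (m + 1 : ℕ) * Y a) * cos (2 * π * (n + 1 : ℕ) * Z a)) := by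
        intro a
        have e2 : ∑ m ∈ range N, ∑ n ∈ range N, c m * c n *
            (cos (2 * π * (m + 1 : ℕ) * Y a) * cos (2 * π * (n + 1 : ℕ) * Z a)) =
            (∑ m ∈ range N, c m * cos (2 * π * (m + 1 : ℕ) * Y a)) *
            ∑ n ∈ range N, c n * cos (2 * π * (n + 1 : ℕ) * Z a) := by
          rw [sum_mul_sum]
          exact sum_congr rfl fun m _ ↦ sum_congr rfl fun n _ ↦ by ring
        rw [e2, tentPartial, tentPartial]
        ring
      have swap₁ : ∀ φ : ℕ → ℕ → ℝ, ∑ a ∈ s, δ ^ 2 * ∑ m ∈ range N, c m * φ m a =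
          δ ^ 2 * ∑ m ∈ range N, c m * ∑ a ∈ s, φ m a := by
        intro φ
        simp_rw [mul_sum]
        exact sum_comm
      have swap₂ : ∀ φ : ℕ → ℕ → ℕ → ℝ,
          ∑ a ∈ s, ∑ m ∈ range N, ∑ n ∈ range N, c m * c n * φ m n a =
          ∑ m ∈ range N, ∑ n ∈ range N, c m * c n * ∑ a ∈ s, φ m n a := by
        intro φ
        simp_rw [mul_sum]
        rw [sum_comm]
        exact sum_congr rfl fun m _ ↦ sum_comm
      simp_rw [e1, sum_add_distrib, sum_const, nsmul_eq_mul]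
      rw [swap₁ fun m a ↦ cos (2 * π * (m + 1 : ℕ) * Y a),
        swap₁ fun m a ↦ cos (2 * π * (m + 1 : ℕ) * Z a),
        swap₂ fun m n a ↦ cos (2 * π * (m + 1 : ℕ) * Y a) * cos (2 * π * (n + 1 : ℕ) * Z a)]
      ring
    rw [expand]
    have single : ∀ V : ℕ → ℝ, (∀ m : ℕ, |V m| ≤ A * r m + B * (1 / r m) + C) →
        |δ ^ 2 * ∑ m ∈ range N, c m * V m| ≤ δ ^ 2 * (A * W₁ + B * W₂ + C * W₀) := by
      intro V hV
      rw [abs_mul, abs_of_nonneg (by positivity : 0 ≤ δ ^ 2)]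
      refine mul_le_mul_of_nonneg_left ?_ (by positivity)
      refine (abs_sum_le_sum_abs _ _).trans ?_
      rw [hW₀, hW₁, hW₂, mul_sum, mul_sum, mul_sum, ← sum_add_distrib, ← sum_add_distrib]
      refine sum_le_sum fun m _ ↦ ?_
      rw [abs_mul, abs_of_nonneg (hc0 m)]
      have := mul_le_mul_of_nonneg_left (hV m) (hc0 m)
      linarith
    have double : ∀ V : ℕ → ℕ → ℝ,
        (∀ m n : ℕ, |V m n| ≤ A * (r m + r n) + B * (1 / r m) + C) →
        |∑ m ∈ range N, ∑ n ∈ range N, c m * c n * V m n| ≤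
          A * (W₁ * W₀ + W₀ * W₁) + B * (W₂ * W₀) + C * (W₀ * W₀) := by
      intro V hV
      refine (abs_sum_le_sum_abs _ _).trans ?_
      refine (sum_le_sum fun m _ ↦ abs_sum_le_sum_abs _ _).trans ?_
      rw [hW₀, hW₁, hW₂]
      simp_rw [sum_mul_sum, mul_add, mul_sum, ← sum_add_distrib]
      refine sum_le_sum fun m _ ↦ sum_le_sum fun n _ ↦ ?_
      rw [abs_mul, abs_of_nonneg (mul_nonneg (hc0 m) (hc0 n))]
      have := mul_le_mul_of_nonneg_left (hV m n) (mul_nonneg (hc0 m) (hc0 n))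
      linarith
    refine (abs_add_le _ _).trans ((add_le_add_left (abs_add_le _ _) _).trans ?_)
    have s1 := single _ hY
    have s2 := single _ hZ
    have s3 := double _ hYZ
    have hδδ : δ ^ 2 ≤ δ := by nlinarith
    have t0 : A * W₁ + B * W₂ + C * W₀ ≤ A * (6 * √δ) + B * (8 * (δ * √δ)) + C * (6 * δ) :=
      add_le_add (add_le_add (mul_le_mul_of_nonneg_left w1 hA) (mul_le_mul_of_nonneg_left w2 hB))
        (mul_le_mul_of_nonneg_left w0 hC)
    have t1 : δ ^ 2 * (A * W₁ + B * W₂ + C * W₀) ≤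
        δ * (A * (6 * √δ) + B * (8 * (δ * √δ)) + C * (6 * δ)) :=
      mul_le_mul hδδ t0 (by positivity) hδ.le
    have t2 : W₁ * W₀ ≤ 6 * √δ * (6 * δ) := mul_le_mul w1 w0 w0' (by positivity)
    have t3 : W₂ * W₀ ≤ 8 * (δ * √δ) * (6 * δ) := mul_le_mul w2 w0 w0' (by positivity)
    have t4 : W₀ * W₀ ≤ 6 * δ * (6 * δ) := mul_le_mul w0 w0 w0' (by positivity)
    have u2 := mul_le_mul_of_nonneg_left t2 hA
    have u3 := mul_le_mul_of_nonneg_left t3 hB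
    have u4 := mul_le_mul_of_nonneg_left t4 hC
    have v3 : 0 ≤ B * (δ ^ 2 * √δ) := by positivity
    have v4 : 0 ≤ C * δ ^ 2 := by positivity
    nlinarith
  refine le_of_tendsto (((tendsto_finsetSum s fun a _ ↦ (tendsto_tentPartial hδ hδ1 (Y a)).mul
    (tendsto_tentPartial hδ hδ1 (Z a))).sub_const _).abs) (Filter.Eventually.of_forall bound)

/-! ### Lattice points near the curve -/

lemma distInt_nonneg (y : ℝ) : 0 ≤ distInt y := abs_nonneg _

lemma tent_nonneg (δ y : ℝ) : 0 ≤ tent δ y := le_max_left _ _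

/-- The tent count along the curve, with a free parameter `ε`: the first error term is of smaller
order than the main term as soon as `q δ⁵` is large. -/
theorem exists_abs_sum_tent_sub_le {f₁ f₂ : ℝ → ℝ} (hf₁ : ContDiffOn ℝ 3 f₁ (Set.Icc 0 1))
    (hf₂ : ContDiffOn ℝ 3 f₂ (Set.Icc 0 1))
    (htors : ∀ x ∈ Set.Icc (0 : ℝ) 1, torsionWithin (monge f₁ f₂) (Set.Icc 0 1) x ≠ 0) :
    ∃ K : ℝ, 0 < K ∧ ∀ q δ ε : ℝ, 2 ≤ q → 0 < δ → δ ≤ 1 / 2 → 0 < ε → ε ≤ 1 →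
      |∑ n ∈ range (⌊q⌋₊ + 1), tent δ (q * f₁ (n / q)) * tent δ (q * f₂ (n / q)) -
        δ ^ 4 * (⌊q⌋₊ + 1 : ℕ)| ≤ K * (√q * (δ * √δ) / ε + ε ^ 2 * (δ ^ 4 * q)) := by
  obtain ⟨K, hK, H⟩ := exists_norm_expSum_le hf₁ hf₂ fun x hx ↦
    secondThirdDet_ne_zero_of_torsionWithin_ne_zero hf₁ hf₂ hx (htors x hx)
  refine ⟨168 * K, by positivity, fun q δ ε hq hδ hδ1 hε hε1 ↦ ?_⟩
  have hq0 : 0 < q := by linarith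
  have h := abs_sum_tent_mul_tent_sub_le hδ hδ1 (range (⌊q⌋₊ + 1)) (fun n ↦ q * f₁ (n / q))
    (fun n ↦ q * f₂ (n / q)) (A := K * √q) (B := K * (√q / (ε * δ))) (C := K * (q * (ε * δ) ^ 2))
    (by positivity) (by positivity) (by positivity) (fun j₁ j₂ J hJ hmax ↦ by
      have := H q j₁ j₂ J (ε * δ) hq hJ hmax (by positivity) (by nlinarith)
      rw [sqrt_mul hq0.le, sqrt_div hq0.le] at this
      simp_rw [mul_add, mul_left_comm q] at this ⊢
      refine this.trans (le_of_eq ?_)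
      ring)
  rw [card_range] at h
  refine h.trans ?_
  have e1 : K * (√q / (ε * δ)) * (δ ^ 2 * √δ) = K * (√q * (δ * √δ) / ε) := by field_simp
  have e2 : K * √q * (δ * √δ) ≤ K * (√q * (δ * √δ) / ε) := by
    rw [mul_assoc]
    refine mul_le_mul_of_nonneg_left ?_ hK.le
    rw [le_div_iff₀ hε]
    exact mul_le_of_le_one_right (by positivity) hε1
  have e3 : K * (q * (ε * δ) ^ 2) * δ ^ 2 = K * (ε ^ 2 * (δ ^ 4 * q)) := by ring
  have e4 : 0 ≤ K * (ε ^ 2 * (δ ^ 4 * q)) := by positivity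
  rw [e1, e3]
  linarith

lemma latticeCount_eq_card (f₁ f₂ : ℝ → ℝ) {q : ℝ} (hq : 0 ≤ q) (δ : ℝ) :
    latticeCount f₁ f₂ q δ = #{n ∈ range (⌊q⌋₊ + 1) |
      distInt (q * f₁ ((n : ℕ) / q)) < δ ∧ distInt (q * f₂ ((n : ℕ) / q)) < δ} := by
  rw [latticeCount, ← card_map Nat.castEmbedding (β := ℤ), ← Set.ncard_coe_finset]
  congr 1
  ext a
  simp only [coe_map, Set.mem_image, coe_filter, mem_range, Set.mem_ofPred_eq, Nat.lt_succ_iff,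
    Nat.castEmbedding_apply, Nat.le_floor_iff hq]
  constructor
  · rintro ⟨h0, h1, h2⟩
    lift a to ℕ using (by exact_mod_cast h0)
    exact ⟨a, ⟨by simpa using h1, by simpa using h2⟩, rfl⟩
  · rintro ⟨n, ⟨h1, h2⟩, rfl⟩
    exact ⟨by positivity, by simpa using h1, by simpa using h2⟩

lemma latticeCount_mono (f₁ f₂ : ℝ → ℝ) {q δ δ' : ℝ} (hq : 0 ≤ q) (h : δ ≤ δ') :
    latticeCount f₁ f₂ q δ ≤ latticeCount f₁ f₂ q δ' := by
  rw [latticeCount_eq_card f₁ f₂ hq, latticeCount_eq_card f₁ f₂ hq]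
  refine card_le_card (monotone_filter_right _ ?_)
  rintro n _ ⟨h1, h2⟩
  exact ⟨h1.trans_le h, h2.trans_le h⟩

lemma latticeCount_le (f₁ f₂ : ℝ → ℝ) {q : ℝ} (hq : 0 ≤ q) (δ : ℝ) :
    (latticeCount f₁ f₂ q δ : ℝ) ≤ q + 1 := by
  rw [latticeCount_eq_card f₁ f₂ hq]
  have h := card_filter_le (range (⌊q⌋₊ + 1)) (fun n : ℕ ↦
    distInt (q * f₁ ((n : ℕ) / q)) < δ ∧ distInt (q * f₂ ((n : ℕ) / q)) < δ)
  rw [card_range] at h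
  have h' : ((#{n ∈ range (⌊q⌋₊ + 1) | distInt (q * f₁ ((n : ℕ) / q)) < δ ∧
    distInt (q * f₂ ((n : ℕ) / q)) < δ} : ℕ) : ℝ) ≤ ⌊q⌋₊ + 1 := by exact_mod_cast h
  linarith [Nat.floor_le hq]

lemma sum_tent_le_mul_latticeCount (f₁ f₂ : ℝ → ℝ) {q δ : ℝ} (hq : 0 ≤ q) (hδ : 0 < δ) :
    ∑ n ∈ range (⌊q⌋₊ + 1), tent δ (q * f₁ (n / q)) * tent δ (q * f₂ (n / q)) ≤
      δ ^ 2 * latticeCount f₁ f₂ q δ := by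
  rw [latticeCount_eq_card f₁ f₂ hq, mul_comm, ← nsmul_eq_mul, ← sum_const, sum_filter]
  refine sum_le_sum fun n _ ↦ ?_
  have hle : ∀ y, tent δ y ≤ δ := fun y ↦ max_le hδ.le (by linarith [distInt_nonneg y])
  have hz : ∀ y, ¬ distInt y < δ → tent δ y = 0 := fun y hy ↦ max_eq_left (by linarith)
  split_ifs with h
  · rw [sq]
    exact mul_le_mul (hle _) (hle _) (tent_nonneg _ _) hδ.le
  · rcases not_and_or.mp h with h | h
    · rw [hz _ h, zero_mul]
    · rw [hz _ h, mul_zero]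

lemma mul_latticeCount_le_sum_tent (f₁ f₂ : ℝ → ℝ) {q δ : ℝ} (hq : 0 ≤ q) (hδ : 0 < δ) :
    δ ^ 2 * latticeCount f₁ f₂ q δ ≤
      ∑ n ∈ range (⌊q⌋₊ + 1), tent (2 * δ) (q * f₁ (n / q)) * tent (2 * δ) (q * f₂ (n / q)) := by
  rw [latticeCount_eq_card f₁ f₂ hq, mul_comm, ← nsmul_eq_mul, ← sum_const, sum_filter]
  refine sum_le_sum fun n _ ↦ ?_
  have hle : ∀ y, distInt y < δ → δ ≤ tent (2 * δ) y :=
    fun y hy ↦ le_max_of_le_right (by linarith)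
  split_ifs with h
  · rw [sq]
    exact mul_le_mul (hle _ h.1) (hle _ h.2) hδ.le (tent_nonneg _ _)
  · exact mul_nonneg (tent_nonneg _ _) (tent_nonneg _ _)

lemma sqrt_mul_pow_five {q δ : ℝ} (hδ : 0 < δ) : √(q * δ ^ 5) = √q * (δ ^ 2 * √δ) := by
  rw [show q * δ ^ 5 = q * ((δ ^ 2) ^ 2 * δ) by ring, sqrt_mul' _ (by positivity),
    sqrt_mul (by positivity), sqrt_sq (by positivity)]

lemma sqrt_mul_le_of_le {q δ C : ℝ} (hq : 0 < q) (hδ : 0 < δ) (hC : 0 < C)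
    (h : C ^ 2 ≤ q * δ ^ 5) : √q * (δ * √δ) ≤ δ ^ 4 * q / C := by
  have h1 : C ≤ √q * (δ ^ 2 * √δ) := by
    rw [← sqrt_mul_pow_five hδ]
    exact le_sqrt_of_sq_le h
  rw [le_div_iff₀ hC]
  refine (mul_le_mul_of_nonneg_left h1 (by positivity)).trans (le_of_eq ?_)
  have hs := mul_self_sqrt hq.le
  have hd := mul_self_sqrt hδ.le
  linear_combination (δ ^ 3 * (√δ * √δ)) * hs + (δ ^ 3 * q) * hd

lemma rpow_neg_fifth_pow_five {q : ℝ} (hq : 0 < q) : (q ^ (-(1 / 5) : ℝ)) ^ 5 = q⁻¹ := by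
  rw [← rpow_natCast, ← rpow_mul hq.le, ← rpow_neg_one]; norm_num

lemma rpow_neg_fifth_sq_mul {q : ℝ} (hq : 0 < q) :
    (q ^ (-(1 / 5) : ℝ)) ^ 2 * q = q ^ (3 / 5 : ℝ) := by
  rw [← rpow_natCast, ← rpow_mul hq.le]
  nth_rewrite 2 [← rpow_one q]
  rw [← rpow_add hq]; norm_num

lemma exists_latticeCount_le_of_one_le {f₁ f₂ : ℝ → ℝ} (hf₁ : ContDiffOn ℝ 3 f₁ (Set.Icc 0 1))
    (hf₂ : ContDiffOn ℝ 3 f₂ (Set.Icc 0 1))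
    (htors : ∀ x ∈ Set.Icc (0 : ℝ) 1, torsionWithin (monge f₁ f₂) (Set.Icc 0 1) x ≠ 0) :
    ∃ K : ℝ, 0 < K ∧ ∀ q δ : ℝ, 2 ≤ q → 0 < δ → 1 ≤ q * δ ^ 5 →
      (latticeCount f₁ f₂ q δ : ℝ) ≤ K * (δ ^ 2 * q) := by
  obtain ⟨K, hK, H⟩ := exists_abs_sum_tent_sub_le hf₁ hf₂ htors
  refine ⟨32 + 32 * K, by positivity, fun q δ hq hδ h5 ↦ ?_⟩
  have hq0 : 0 < q := by linarith
  rcases le_or_gt δ (1 / 4) with hδ4 | hδ4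
  · have h1 := mul_latticeCount_le_sum_tent f₁ f₂ hq0.le hδ
    have h2 := (abs_le.mp (H q (2 * δ) 1 hq (by linarith) (by linarith) one_pos le_rfl)).2
    have h3 := sqrt_mul_le_of_le (q := q) (δ := 2 * δ) hq0 (by linarith) one_pos (by nlinarith)
    have hN : ((⌊q⌋₊ + 1 : ℕ) : ℝ) ≤ 2 * q := by
      push_cast; linarith [Nat.floor_le hq0.le]
    have h4 := mul_le_mul_of_nonneg_left hN (show 0 ≤ (2 * δ) ^ 4 by positivity)
    have h5 : K * (√q * (2 * δ * √(2 * δ)) / 1 + 1 ^ 2 * ((2 * δ) ^ 4 * q)) ≤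
        K * (2 * ((2 * δ) ^ 4 * q)) := by
      refine mul_le_mul_of_nonneg_left ?_ hK.le
      rw [div_one] at h3 ⊢
      linarith
    have h6 : δ ^ 2 * latticeCount f₁ f₂ q δ ≤ δ ^ 2 * ((32 + 32 * K) * (δ ^ 2 * q)) := by
      linarith
    exact le_of_mul_le_mul_left h6 (by positivity)
  · have h1 := latticeCount_le f₁ f₂ hq0.le δ
    have h2 : 1 / 16 ≤ δ ^ 2 := by nlinarith
    have h3 := mul_le_mul_of_nonneg_right h2 hq0.le
    have h4 : 0 ≤ 32 * K * (δ ^ 2 * q) := by positivity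
    linarith

end SpaceCurve

theorem theorem1 (f₁ f₂ : ℝ → ℝ)
    (hf₁ : ContDiffOn ℝ 3 f₁ (Set.Icc 0 1)) (hf₂ : ContDiffOn ℝ 3 f₂ (Set.Icc 0 1))
    (htors : ∀ x ∈ Set.Icc (0 : ℝ) 1,
      SpaceCurve.torsionWithin (SpaceCurve.monge f₁ f₂) (Set.Icc 0 1) x ≠ 0) :
    (∃ K : ℝ, 0 < K ∧ ∀ q δ : ℝ, 2 ≤ q → 0 < δ → δ < 1 / 2 →
      (SpaceCurve.latticeCount f₁ f₂ q δ : ℝ) ≤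
        K * (δ ^ 2 * q + q ^ (3 / 5 : ℝ) * Real.log q ^ (4 / 5 : ℝ))) ∧
    (∃ C Q₀ c : ℝ, 0 < C ∧ 0 < Q₀ ∧ 0 < c ∧ ∀ q δ : ℝ, Q₀ ≤ q → 0 < δ → δ < 1 / 2 →
      C * q ^ (-(1 / 5) : ℝ) * Real.log q ^ (2 / 5 : ℝ) ≤ δ →
      c * (δ ^ 2 * q) ≤ (SpaceCurve.latticeCount f₁ f₂ q δ : ℝ)) := by
  constructor
  · obtain ⟨K, hK, H⟩ := SpaceCurve.exists_latticeCount_le_of_one_le hf₁ hf₂ htors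
    set l : ℝ := log 2 ^ (4 / 5 : ℝ) with hl
    have hl0 : 0 < l := rpow_pos_of_pos (log_pos one_lt_two) _
    refine ⟨K * (1 + 1 / l), by positivity, fun q δ hq hδ _ ↦ ?_⟩
    have hq0 : 0 < q := by linarith
    set δ₀ : ℝ := q ^ (-(1 / 5) : ℝ) with hδ₀
    have hδ₀0 : 0 < δ₀ := rpow_pos_of_pos hq0 _
    have h1 : q * δ₀ ^ 5 = 1 := by
      rw [hδ₀, SpaceCurve.rpow_neg_fifth_pow_five hq0]; exact mul_inv_cancel₀ hq0.ne'
    -- for `δ < q ^ (-1 / 5)` the count is at most that for `δ₀ = q ^ (-1 / 5)`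
    have h2 : 1 ≤ q * (max δ δ₀) ^ 5 := by
      rw [← h1]
      exact mul_le_mul_of_nonneg_left (pow_le_pow_left₀ hδ₀0.le (le_max_right _ _) 5) hq0.le
    have h3 := H q (max δ δ₀) hq (lt_max_of_lt_left hδ) h2
    have h4 : (SpaceCurve.latticeCount f₁ f₂ q δ : ℝ) ≤
        SpaceCurve.latticeCount f₁ f₂ q (max δ δ₀) := by
      exact_mod_cast SpaceCurve.latticeCount_mono f₁ f₂ hq0.le (le_max_left _ _)
    have h5 : (max δ δ₀) ^ 2 * q ≤ δ ^ 2 * q + q ^ (3 / 5 : ℝ) := by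
      rw [← SpaceCurve.rpow_neg_fifth_sq_mul hq0, ← hδ₀]
      have a : 0 ≤ δ ^ 2 * q := by positivity
      have b : 0 ≤ δ₀ ^ 2 * q := by positivity
      rcases max_choice δ δ₀ with h | h <;> rw [h] <;> linarith
    have h6 : l ≤ log q ^ (4 / 5 : ℝ) :=
      rpow_le_rpow (log_pos one_lt_two).le (log_le_log two_pos hq) (by norm_num)
    have hq35 : 0 < q ^ (3 / 5 : ℝ) := rpow_pos_of_pos hq0 _
    have h7 : q ^ (3 / 5 : ℝ) ≤ 1 / l * (q ^ (3 / 5 : ℝ) * log q ^ (4 / 5 : ℝ)) := by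
      rw [one_div_mul_eq_div, le_div_iff₀ hl0]
      exact mul_le_mul_of_nonneg_left h6 hq35.le
    have h8 : 0 ≤ q ^ (3 / 5 : ℝ) * log q ^ (4 / 5 : ℝ) :=
      mul_nonneg hq35.le (hl0.le.trans h6)
    have h9 : 0 ≤ 1 / l * (δ ^ 2 * q) := by positivity
    refine h4.trans (h3.trans ?_)
    rw [mul_assoc]
    refine mul_le_mul_of_nonneg_left ?_ hK.le
    linarith
  · obtain ⟨K, hK, H⟩ := SpaceCurve.exists_abs_sum_tent_sub_le hf₁ hf₂ htors
    -- `ε` and `C` make each of the two error terms at most a quarter of the main term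
    set ε : ℝ := 1 / (2 * (K + 1)) with hε
    have hε0 : 0 < ε := by positivity
    have hε1 : ε ≤ 1 := by
      rw [hε, div_le_one (by positivity)]; linarith
    have hKε : K * ε ^ 2 ≤ 1 / 4 := by
      rw [hε, div_pow, one_pow, mul_one_div, div_le_div_iff₀ (by positivity) (by norm_num)]
      nlinarith
    set C : ℝ := 4 * K / ε + 1 with hC
    have hC1 : 1 ≤ C := by
      have : 0 ≤ 4 * K / ε := by positivity
      linarith
    have hC0 : 0 < C := by linarith
    refine ⟨C, exp 1, 1 / 2, hC0, exp_pos 1, by norm_num, fun q δ hq hδ hδ1 hCδ ↦ ?_⟩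
    have hq2 : 2 ≤ q := by
      have := add_one_le_exp (1 : ℝ)
      linarith
    have hq0 : 0 < q := by linarith
    have hlog : 1 ≤ log q ^ (2 / 5 : ℝ) := by
      refine one_le_rpow ?_ (by norm_num)
      rwa [le_log_iff_exp_le hq0]
    set δ₀ : ℝ := q ^ (-(1 / 5) : ℝ) with hδ₀
    have hδ₀0 : 0 < δ₀ := rpow_pos_of_pos hq0 _
    have h1 : q * δ₀ ^ 5 = 1 := by
      rw [hδ₀, SpaceCurve.rpow_neg_fifth_pow_five hq0]; exact mul_inv_cancel₀ hq0.ne'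
    have h2 : C * δ₀ ≤ δ := (le_mul_of_one_le_right (by positivity) hlog).trans hCδ
    have h3 : C ^ 2 ≤ q * δ ^ 5 := by
      have a : C ^ 2 ≤ C ^ 5 := pow_le_pow_right₀ hC1 (by norm_num)
      have b := mul_le_mul_of_nonneg_left (pow_le_pow_left₀ (by positivity) h2 5) hq0.le
      have c : q * (C * δ₀) ^ 5 = C ^ 5 := by linear_combination C ^ 5 * h1
      linarith
    have h4 := SpaceCurve.sqrt_mul_le_of_le hq0 hδ hC0 h3
    have h5 := (abs_le.mp (H q δ ε hq2 hδ hδ1.le hε0 hε1)).1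
    have h6 := SpaceCurve.sum_tent_le_mul_latticeCount f₁ f₂ hq0.le hδ
    have hX : 0 < δ ^ 4 * q := by positivity
    have h7 : K * (√q * (δ * √δ) / ε) ≤ 1 / 4 * (δ ^ 4 * q) := by
      have a : K * (√q * (δ * √δ) / ε) ≤ K * (δ ^ 4 * q / C / ε) :=
        mul_le_mul_of_nonneg_left (div_le_div_of_nonneg_right h4 hε0.le) hK.le
      have b : K * (δ ^ 4 * q / C / ε) = K / (C * ε) * (δ ^ 4 * q) := by field_simp
      have c : K / (C * ε) ≤ 1 / 4 := by
        have : C * ε = 4 * K + ε := by rw [hC]; field_simp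
        rw [this, div_le_div_iff₀ (by positivity) (by norm_num)]
        linarith
      rw [b] at a
      exact a.trans (mul_le_mul_of_nonneg_right c hX.le)
    have h8 : K * (ε ^ 2 * (δ ^ 4 * q)) ≤ 1 / 4 * (δ ^ 4 * q) := by
      rw [← mul_assoc]
      exact mul_le_mul_of_nonneg_right hKε hX.le
    have h9 : δ ^ 4 * q ≤ δ ^ 4 * ((⌊q⌋₊ + 1 : ℕ) : ℝ) := by
      refine mul_le_mul_of_nonneg_left ?_ (by positivity)
      push_cast
      exact (Nat.lt_floor_add_one q).le
    have h10 : δ ^ 2 * (1 / 2 * (δ ^ 2 * q)) ≤ δ ^ 2 * SpaceCurve.latticeCount f₁ f₂ q δ := by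
      linarith
    exact le_of_mul_le_mul_left h10 (by positivity)
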